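/- Let $G$ be a (finite-dimensional, Hausdorff, not necessarily compact) Lie group, $H\subseteq G$ a closed subgroup, and $k\in\{0,1,2,\dots,\infty\}$; a map on an open subset of $G/H$ (or of $G\times G/H$) is called of class $C^k$ if its composite with the quotient map from $G$ (resp. $G\times G$) is. A $G$-vector bundle of class $C^k$ over $G/H$ is a complex vector bundle $E\to G/H$ of finite rank and of class $C^k$, with an action $G\times E\to E$ of class $C^k$ that covers the action of $G$ on $G/H$ and is linear on the fibres; isomorphisms of $G$-vector bundles are $G$-equivariant, fibrewise linear, and of class $C^k$ together with their inverses. ($k=\infty$ gives smooth, $k=0$ topological $G$-vector bundles.) Let $K_G(G/H)$ be the Grothendieck ring of the commutative semiring of isomorphism classes of $G$-vector bundles of class $C^k$ over $G/H$ under $\oplus$ and $\otimes$. An $H$-module is a finite-dimensional complex vector space $M$ with a continuous linear action of $H$, and $R(H)$ is the Grothendieck ring of the commutative semiring of isomorphism classes of $H$-modules under $\oplus$ and $\otimes$. For an $H$-module $M$ let $G\times_H M$ be the quotient of $G\times M$ by $(g,m)\sim(gh^{-1},hm)$, $h\in H$, with projection $[g,m]\mapsto gH$ and $G$-action $a\cdot[g,m]=[ag,m]$.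 Then: 1. For every $H$-module $M$, $G\times_H M$ (with the $C^k$ structure induced from $G\times M$) is locally trivial, hence a $G$-vector bundle of class $C^k$ over $G/H$. 2. For every $G$-vector bundle $E$ of class $C^k$ over $G/H$, the fibre $M=E_{H}$ over the identity coset is an $H$-module under the restricted action, and $[g,m]\mapsto g\cdot m$ is a well-defined isomorphism of $G$-vector bundles $G\times_H M\to E$. 3. There is a ring isomorphism $K_G(G/H)\cong R(H)$ that sends $[E]$ to $[E_{H}]$ for every $G$-vector bundle $E$, and whose inverse sends $[M]$ to $[G\times_H M]$ for every $H$-module $M$. -/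

import Mathlib

open scoped Manifold ContDiff TensorProduct
open Module (Dual)
universe u v
namespace EquivariantK

section GrothendieckRing
open Algebra

/-- The Grothendieck ring of a commutative semiring: the group of formal differences, with the
product extended biadditively. -/
def GrothendieckRing (S : Type*) [CommSemiring S] : Type _ := GrothendieckAddGroup S

namespace GrothendieckRing
variable (S : Type*) [CommSemiring S]

instance instAddCommGroup : AddCommGroup (GrothendieckRing S) :=
  inferInstanceAs (AddCommGroup (GrothendieckAddGroup S))

variable {S}

/-- The class of an element of the semiring. -/
def of : S →+ GrothendieckRing S := GrothendieckAddGroup.of (M := S)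

/-- The universal property. -/
noncomputable def lift {A : Type*} [AddCommGroup A] (f : S →+ A) : GrothendieckRing S →+ A :=
  GrothendieckAddGroup.lift (M := S) f

theorem lift_of {A : Type*} [AddCommGroup A] (f : S →+ A) (a : S) : lift f (of a) = f a :=
  DFunLike.congr_fun (GrothendieckAddGroup.lift.symm_apply_apply f) a

theorem hom_ext {A : Type*} [AddCommGroup A] {f g : GrothendieckRing S →+ A}
    (h : ∀ a, f (of a) = g (of a)) : f = g :=
  GrothendieckAddGroup.lift.symm.injective (AddMonoidHom.ext h)

/-- The biadditive extension of the product. -/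
noncomputable def mulHom : GrothendieckRing S →+ GrothendieckRing S →+ GrothendieckRing S :=
  lift ((AddMonoidHom.flip (lift
    (AddMonoidHom.flip ((AddMonoidHom.compHom (of (S := S))).comp AddMonoidHom.mul)))))

noncomputable instance : Mul (GrothendieckRing S) := ⟨fun x y => mulHom x y⟩
noncomputable instance : One (GrothendieckRing S) := ⟨of 1⟩

theorem mul_def (x y : GrothendieckRing S) : x * y = mulHom x y := rfl

theorem of_mul (a b : S) : of (a * b) = of a * of b := by
  simp [mul_def, mulHom, lift_of]

theorem of_one : of (1 : S) = 1 := rfl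

/-- An additive identity holds everywhere as soon as it holds on classes. -/
theorem induction {p : GrothendieckRing S → Prop} (x : GrothendieckRing S)
    (h : ∀ a, p (of a)) (hs : ∀ x y, p x → p y → p (x - y)) : p x := by
  induction x using AddLocalization.ind with
  | _ y =>
    have : (AddLocalization.mk y.1 y.2 : GrothendieckAddGroup S) =
        (of y.1 : GrothendieckRing S) - of (y.2 : S) := by
      symm
      exact (GrothendieckAddGroup.mk_sub_mk (M := S) y.1 y.2.1 0 0).trans (by simp)
    rw [this]
    exact hs _ _ (h _) (h _)

theorem sub_mul' (x y z : GrothendieckRing S) : (x - y) * z = x * z - y * z := by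
  simp [mul_def]
theorem mul_sub' (x y z : GrothendieckRing S) : x * (y - z) = x * y - x * z := by
  simp [mul_def]

theorem mul_comm' (x y : GrothendieckRing S) : x * y = y * x := by
  induction x using induction with
  | h a =>
    induction y using induction with
    | h b => rw [← of_mul, ← of_mul, mul_comm]
    | hs y z hy hz => rw [mul_sub', sub_mul', hy, hz]
  | hs x z hx hz => rw [mul_sub', sub_mul', hx, hz]

noncomputable instance instCommRing : CommRing (GrothendieckRing S) where
  __ := instAddCommGroup S
  left_distrib x y z := by simp [mul_def]
  right_distrib x y z := by simp [mul_def]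
  zero_mul x := by simp [mul_def]
  mul_zero x := by simp [mul_def]
  mul_comm := mul_comm'
  mul_assoc x y z := by
    induction x using induction with
    | h a =>
      induction y using induction with
      | h b =>
        induction z using induction with
        | h c => simp only [← of_mul, mul_assoc]
        | hs z w hz hw => simp only [mul_sub', hz, hw]
      | hs z w hz hw => simp only [mul_sub', sub_mul', hz, hw]
    | hs z w hz hw => simp only [sub_mul', hz, hw]
  one_mul x := by
    induction x using induction with
    | h a => rw [← of_one, ← of_mul, one_mul]
    | hs z w hz hw => rw [mul_sub', hz, hw]
  mul_one x := by
    induction x using induction with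
    | h a => rw [← of_one, ← of_mul, mul_one]
    | hs z w hz hw => rw [sub_mul', hz, hw]
end GrothendieckRing
end GrothendieckRing

section Smooth

variable {V : Type v} [NormedAddCommGroup V] [NormedSpace ℝ V]
  {P : Type u} [TopologicalSpace P] [ChartedSpace V P]

/-- `f` is of class `C^k` (in the real sense) on the subset `s` of the manifold `P`. -/
def CkOn (V : Type*) [NormedAddCommGroup V] [NormedSpace ℝ V] {P : Type*} [TopologicalSpace P]
    [ChartedSpace V P] (k : ℕ∞) (s : Set P) (f : P → ℂ) : Prop :=
  ContMDiffOn 𝓘(ℝ, V) 𝓘(ℝ, ℂ) k f s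

/-- `f` is of class `C^k` (in the real sense) on the subset `s` of the product manifold `P × P`. -/
def CkOn₂ (V : Type*) [NormedAddCommGroup V] [NormedSpace ℝ V] {P : Type*} [TopologicalSpace P]
    [ChartedSpace V P] (k : ℕ∞) (s : Set (P × P)) (f : P × P → ℂ) : Prop :=
  ContMDiffOn (𝓘(ℝ, V).prod 𝓘(ℝ, V)) 𝓘(ℝ, ℂ) k f s

theorem contMDiffOn_mul {E' H' N : Type*} [NormedAddCommGroup E'] [NormedSpace ℝ E']
    [TopologicalSpace H'] {J : ModelWithCorners ℝ E' H'} [TopologicalSpace N] [ChartedSpace H' N]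
    {n : WithTop ℕ∞} {s : Set N} {f g : N → ℂ} (hf : ContMDiffOn J 𝓘(ℝ, ℂ) n f s)
    (hg : ContMDiffOn J 𝓘(ℝ, ℂ) n g s) : ContMDiffOn J 𝓘(ℝ, ℂ) n (fun x => f x * g x) s :=
  fun x hx => ContDiff.comp_contMDiffWithinAt
    (g := fun p : ℂ × ℂ => p.1 * p.2) contDiff_mul ((hf x hx).prodMk_space (hg x hx))

theorem CkOn.mul {k : ℕ∞} {s : Set P} {f g : P → ℂ} (hf : CkOn V k s f) (hg : CkOn V k s g) :
    CkOn V k s (fun x => f x * g x) := contMDiffOn_mul hf hg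

theorem CkOn₂.mul {k : ℕ∞} {s : Set (P × P)} {f g : P × P → ℂ} (hf : CkOn₂ V k s f)
    (hg : CkOn₂ V k s g) : CkOn₂ V k s (fun x => f x * g x) := contMDiffOn_mul hf hg

theorem CkOn.sum {k : ℕ∞} {s : Set P} {ι : Type*} [Fintype ι] {f : ι → P → ℂ}
    (hf : ∀ i, CkOn V k s (f i)) : CkOn V k s (fun x => ∑ i, f i x) :=
  contMDiffOn_finsetSum fun i _ => hf i

theorem CkOn₂.sum {k : ℕ∞} {s : Set (P × P)} {ι : Type*} [Fintype ι] {f : ι → P × P → ℂ}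
    (hf : ∀ i, CkOn₂ V k s (f i)) : CkOn₂ V k s (fun x => ∑ i, f i x) :=
  contMDiffOn_finsetSum fun i _ => hf i

theorem CkOn.const {k : ℕ∞} {s : Set P} (c : ℂ) : CkOn V k s (fun _ => c) := contMDiffOn_const
theorem CkOn₂.const {k : ℕ∞} {s : Set (P × P)} (c : ℂ) : CkOn₂ V k s (fun _ => c) :=
  contMDiffOn_const

theorem CkOn.congr {k : ℕ∞} {s : Set P} {f g : P → ℂ} (hf : CkOn V k s f)
    (h : ∀ x ∈ s, g x = f x) : CkOn V k s g := ContMDiffOn.congr hf h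
theorem CkOn₂.congr {k : ℕ∞} {s : Set (P × P)} {f g : P × P → ℂ} (hf : CkOn₂ V k s f)
    (h : ∀ x ∈ s, g x = f x) : CkOn₂ V k s g := ContMDiffOn.congr hf h

theorem CkOn.mono {k : ℕ∞} {s t : Set P} {f : P → ℂ} (hf : CkOn V k s f) (h : t ⊆ s) :
    CkOn V k t f := ContMDiffOn.mono hf h
theorem CkOn₂.mono {k : ℕ∞} {s t : Set (P × P)} {f : P × P → ℂ} (hf : CkOn₂ V k s f) (h : t ⊆ s) :
    CkOn₂ V k t f := ContMDiffOn.mono hf h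

theorem CkOn.comp_snd {k : ℕ∞} {s : Set P} {t : Set (P × P)} {f : P → ℂ} (hf : CkOn V k s f)
    (h : ∀ p ∈ t, p.2 ∈ s) : CkOn₂ V k t (fun p => f p.2) :=
  ContMDiffOn.comp hf contMDiff_snd.contMDiffOn h

theorem CkOn.comp_mul [Group P] [LieGroup 𝓘(ℝ, V) ∞ P] {k : ℕ∞} {s : Set P} {t : Set (P × P)}
    {f : P → ℂ} (hf : CkOn V k s f) (h : ∀ p ∈ t, p.1 * p.2 ∈ s) :
    CkOn₂ V k t (fun p => f (p.1 * p.2)) :=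
  ContMDiffOn.comp hf ((contMDiff_mul 𝓘(ℝ, V) ∞).of_le (by exact_mod_cast le_top)).contMDiffOn h

theorem CkOn.of_locally {k : ℕ∞} {s : Set P} {f : P → ℂ}
    (h : ∀ x ∈ s, ∃ u, IsOpen u ∧ x ∈ u ∧ CkOn V k (s ∩ u) f) : CkOn V k s f :=
  contMDiffOn_of_locally_contMDiffOn h

end Smooth

section Bundles

variable {V : Type v} [NormedAddCommGroup V] [NormedSpace ℝ V]
  {G : Type u} [TopologicalSpace G] [Group G] [ChartedSpace V G]

/-- A local frame, over an open set `base`, of a family of complex vector spaces indexed by `G/H`: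
the vectors `vec x i` form a basis of the fibre `E x` for every `x ∈ base`, and `coord x` is the
corresponding coordinate isomorphism `E x ≃ ℂ^ι`, i.e. the local trivialization given by the frame.
Outside `base` the values of `vec` and `coord` carry no information. -/
structure LocalFrame (H : Subgroup G) (E : G ⧸ H → Type u) [∀ x, AddCommGroup (E x)]
    [∀ x, Module ℂ (E x)] where
  base : Set (G ⧸ H)
  isOpen_base : IsOpen base
  ι : Type
  [fintype : Fintype ι]
  [decEq : DecidableEq ι]
  vec : ∀ x, ι → E x
  coord : ∀ x, E x →ₗ[ℂ] (ι → ℂ)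
  coord_vec : ∀ x ∈ base, ∀ i j, coord x (vec x i) j = if i = j then 1 else 0
  sum_coord : ∀ x ∈ base, ∀ v, ∑ i, coord x v i • vec x i = v

attribute [instance] LocalFrame.fintype LocalFrame.decEq

namespace LocalFrame
variable {H : Subgroup G} {E : G ⧸ H → Type u} [∀ x, AddCommGroup (E x)] [∀ x, Module ℂ (E x)]

/-- The preimage in `G` of the base of a frame. -/
def pre (e : LocalFrame H E) : Set G := {g | (g : G ⧸ H) ∈ e.base}

theorem isOpen_pre (e : LocalFrame H E) : IsOpen e.pre :=
  e.isOpen_base.preimage continuous_quotient_mk'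

theorem map_eq (e : LocalFrame H E) {x : G ⧸ H} (hx : x ∈ e.base) {W : Type*} [AddCommGroup W]
    [Module ℂ W] (L : E x →ₗ[ℂ] W) (v : E x) : L v = ∑ i, e.coord x v i • L (e.vec x i) := by
  conv_lhs => rw [← e.sum_coord x hx v]
  simp

end LocalFrame

variable (V) in
/-- A `G`-equivariant family of complex vector spaces over `G/H` with a `C^k` structure.

A function on an open subset of `G/H` is of class `C^k` exactly when its composite with the
quotient map `G → G/H` is (this is the universal property of the quotient topology if `k = 0`, and
of the quotient manifold `G/H` in general), and similarly for `G × G → G × G/H`.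
The total space is the disjoint union of the fibres, and its topology (`k = 0`) or differentiable
structure is given, as in the usual construction of vector bundles from local trivializations, by a
set of local frames whose transition functions are of class `C^k`. For `g • x = y`, `act g` is the map `E_x → E_y`, `v ↦ g • v`;
`contMDiff_act` says that in local trivializations the action `G × E → E` is of class `C^k`. -/
structure EquivariantFamily (k : ℕ∞) (H : Subgroup G) where
  fib : G ⧸ H → Type u
  [addCommGroup : ∀ x, AddCommGroup (fib x)]
  [module : ∀ x, Module ℂ (fib x)]
  act : ∀ (g : G) {x y : G ⧸ H}, g • x = y → (fib x →ₗ[ℂ] fib y)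
  act_one : ∀ {x : G ⧸ H} (h : (1 : G) • x = x) (v : fib x), act 1 h v = v
  act_mul : ∀ (a b : G) {x y z : G ⧸ H} (hb : b • x = y) (ha : a • y = z) (hab : (a * b) • x = z)
    (v : fib x), act (a * b) hab v = act a ha (act b hb v)
  frames : Set (LocalFrame H fib)
  contMDiff_transition : ∀ e ∈ frames, ∀ f ∈ frames, ∀ i j,
    CkOn V k (e.pre ∩ f.pre) (fun g => f.coord g (e.vec g i) j)
  contMDiff_act : ∀ e ∈ frames, ∀ f ∈ frames, ∀ i j,
    CkOn₂ V k {p : G × G | p.2 ∈ e.pre ∧ p.1 * p.2 ∈ f.pre}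
      (fun p => f.coord (p.1 • (p.2 : G ⧸ H)) (act p.1 rfl (e.vec p.2 i)) j)

attribute [instance] EquivariantFamily.addCommGroup EquivariantFamily.module

/-- Local triviality: there is a local frame around every point. -/
def EquivariantFamily.IsLocallyTrivial {k : ℕ∞} {H : Subgroup G} (E : EquivariantFamily V k H) :
    Prop := ∀ x : G ⧸ H, ∃ e ∈ E.frames, x ∈ e.base

variable (V) in
/-- A complex `G`-vector bundle of class `C^k` over `G/H` (of finite, possibly varying, rank). -/
structure GVectorBundle (k : ℕ∞) (H : Subgroup G) extends EquivariantFamily V k H where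
  isLocallyTrivial : toEquivariantFamily.IsLocallyTrivial

variable {k : ℕ∞} {H : Subgroup G}

/-- A family of linear maps between fibres is of class `C^k` if it is so in all local frames. -/
def IsCkMap (E F : EquivariantFamily V k H) (φ : ∀ x, E.fib x →ₗ[ℂ] F.fib x) : Prop :=
  ∀ e ∈ E.frames, ∀ f ∈ F.frames, ∀ i j,
    CkOn V k (e.pre ∩ f.pre) (fun g => f.coord g (φ g (e.vec g i)) j)

/-- A `G`-isomorphism: fibrewise linear isomorphisms that commute with the actions of `G` and are
of class `C^k` together with their inverses. -/
structure GIso (E F : EquivariantFamily V k H) where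
  toEquiv : ∀ x, E.fib x ≃ₗ[ℂ] F.fib x
  map_act : ∀ (g : G) {x y : G ⧸ H} (h : g • x = y) (v : E.fib x),
    toEquiv y (E.act g h v) = F.act g h (toEquiv x v)
  isCkMap : IsCkMap E F fun x => (toEquiv x : E.fib x →ₗ[ℂ] F.fib x)
  isCkMap_symm : IsCkMap F E fun x => ((toEquiv x).symm : F.fib x →ₗ[ℂ] E.fib x)

theorem IsCkMap.comp {E F K : EquivariantFamily V k H} (hF : F.IsLocallyTrivial)
    {φ : ∀ x, E.fib x →ₗ[ℂ] F.fib x} {ψ : ∀ x, F.fib x →ₗ[ℂ] K.fib x}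
    (hφ : IsCkMap E F φ) (hψ : IsCkMap F K ψ) : IsCkMap E K fun x => (ψ x).comp (φ x) := by
  intro e he f hf i j
  refine CkOn.of_locally fun g _ => ?_
  obtain ⟨d, hd, hgd⟩ := hF (g : G ⧸ H)
  refine ⟨d.pre, d.isOpen_pre, hgd, ?_⟩
  refine (CkOn.sum (fun a => ((hφ e he d hd i a).mono ?_).mul
    ((hψ d hd f hf a j).mono ?_))).congr ?_
  · exact fun x hx => ⟨hx.1.1, hx.2⟩
  · exact fun x hx => ⟨hx.2, hx.1.2⟩
  · intro x hx
    have := d.map_eq hx.2 ((LinearMap.proj j).comp ((f.coord x).comp (ψ x))) (φ x (e.vec x i))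
    simpa using this

/-- A family of linear maps that matches, around every point, a frame with a frame is `C^k`. -/
theorem IsCkMap.of_matching {E F : EquivariantFamily V k H} (φ : ∀ x, E.fib x →ₗ[ℂ] F.fib x)
    (h : ∀ x, ∃ e ∈ E.frames, ∃ f ∈ F.frames, x ∈ e.base ∧ x ∈ f.base ∧ ∃ σ : e.ι → f.ι,
      ∀ y, y ∈ e.base → y ∈ f.base → ∀ i, φ y (e.vec y i) = f.vec y (σ i)) : IsCkMap E F φ := by
  intro e he f hf i j
  refine CkOn.of_locally fun g _ => ?_
  obtain ⟨e', he', f', hf', h1, h2, σ, hσ⟩ := h (g : G ⧸ H)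
  refine ⟨e'.pre ∩ f'.pre, e'.isOpen_pre.inter f'.isOpen_pre, ⟨h1, h2⟩, ?_⟩
  refine (CkOn.sum (fun a => ((E.contMDiff_transition e he e' he' i a).mono ?_).mul
    ((F.contMDiff_transition f' hf' f hf (σ a) j).mono ?_))).congr ?_
  · exact fun x hx => ⟨hx.1.1, hx.2.1⟩
  · exact fun x hx => ⟨hx.2.2, hx.1.2⟩
  · intro x hx
    have := e'.map_eq hx.2.1 ((LinearMap.proj j).comp ((f.coord x).comp (φ x))) (e.vec x i)
    simp only [LinearMap.comp_apply, LinearMap.proj_apply, smul_eq_mul] at this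
    rw [this]
    refine Finset.sum_congr rfl fun a _ => ?_
    rw [hσ _ hx.2.1 hx.2.2]

namespace GIso

/-- The identity. -/
def refl (E : EquivariantFamily V k H) : GIso E E where
  toEquiv _ := LinearEquiv.refl ℂ _
  map_act _ _ _ _ _ := rfl
  isCkMap := E.contMDiff_transition
  isCkMap_symm := E.contMDiff_transition

/-- The inverse. -/
def symm {E F : EquivariantFamily V k H} (φ : GIso E F) : GIso F E where
  toEquiv x := (φ.toEquiv x).symm
  map_act _ _ _ _ _ := by
    rw [LinearEquiv.symm_apply_eq, φ.map_act, LinearEquiv.apply_symm_apply]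
  isCkMap := φ.isCkMap_symm
  isCkMap_symm := φ.isCkMap

/-- The composite. -/
def trans {E F K : EquivariantFamily V k H} (hF : F.IsLocallyTrivial) (φ : GIso E F)
    (ψ : GIso F K) : GIso E K where
  toEquiv x := (φ.toEquiv x).trans (ψ.toEquiv x)
  map_act g x y h v := by simp [φ.map_act, ψ.map_act]
  isCkMap := IsCkMap.comp hF φ.isCkMap ψ.isCkMap
  isCkMap_symm := IsCkMap.comp hF ψ.isCkMap_symm φ.isCkMap_symm

/-- An equivariant family of linear isomorphisms that matches frames with frames. -/
def ofMatching {E F : EquivariantFamily V k H} (φ : ∀ x, E.fib x ≃ₗ[ℂ] F.fib x)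
    (hφ : ∀ (g : G) {x y : G ⧸ H} (h : g • x = y) (v : E.fib x),
      φ y (E.act g h v) = F.act g h (φ x v))
    (h : ∀ x, ∃ e ∈ E.frames, ∃ f ∈ F.frames, x ∈ e.base ∧ x ∈ f.base ∧ ∃ σ : e.ι ≃ f.ι,
      ∀ y, y ∈ e.base → y ∈ f.base → ∀ i, φ y (e.vec y i) = f.vec y (σ i)) : GIso E F where
  toEquiv := φ
  map_act := hφ
  isCkMap := IsCkMap.of_matching _ fun x => by
    obtain ⟨e, he, f, hf, h1, h2, σ, hσ⟩ := h x
    exact ⟨e, he, f, hf, h1, h2, σ, hσ⟩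
  isCkMap_symm := IsCkMap.of_matching _ fun x => by
    obtain ⟨e, he, f, hf, h1, h2, σ, hσ⟩ := h x
    refine ⟨f, hf, e, he, h2, h1, σ.symm, fun y hy hy' i => ?_⟩
    simp [LinearEquiv.symm_apply_eq, hσ y hy' hy]

end GIso

/-! ### Direct sums and tensor products -/

section Operations

namespace LocalFrame
variable {E F : G ⧸ H → Type u} [∀ x, AddCommGroup (E x)] [∀ x, Module ℂ (E x)]
  [∀ x, AddCommGroup (F x)] [∀ x, Module ℂ (F x)]

/-- The frame of a direct sum. -/
def sum (e : LocalFrame H E) (f : LocalFrame H F) : LocalFrame H (fun x => E x × F x) where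
  base := e.base ∩ f.base
  isOpen_base := e.isOpen_base.inter f.isOpen_base
  ι := e.ι ⊕ f.ι
  vec x := Sum.elim (fun i => (e.vec x i, 0)) (fun j => (0, f.vec x j))
  coord x := LinearMap.pi (Sum.elim
    (fun i => (LinearMap.proj i).comp ((e.coord x).comp (LinearMap.fst ℂ (E x) (F x))))
    (fun j => (LinearMap.proj j).comp ((f.coord x).comp (LinearMap.snd ℂ (E x) (F x)))))
  coord_vec x hx := by
    rintro (i | i) (j | j) <;> simp [e.coord_vec x hx.1, f.coord_vec x hx.2]
  sum_coord x hx := by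
    rintro ⟨v, w⟩
    rw [Fintype.sum_sum_type]
    ext
    · simpa [Prod.fst_sum] using e.sum_coord x hx.1 v
    · simpa [Prod.snd_sum] using f.sum_coord x hx.2 w

/-- The frame of a tensor product. -/
noncomputable def tensor (e : LocalFrame H E) (f : LocalFrame H F) :
    LocalFrame H (fun x => E x ⊗[ℂ] F x) where
  base := e.base ∩ f.base
  isOpen_base := e.isOpen_base.inter f.isOpen_base
  ι := e.ι × f.ι
  vec x p := e.vec x p.1 ⊗ₜ f.vec x p.2
  coord x := LinearMap.pi fun p => LinearMap.mul' ℂ ℂ ∘ₗ TensorProduct.map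
    ((LinearMap.proj p.1).comp (e.coord x)) ((LinearMap.proj p.2).comp (f.coord x))
  coord_vec x hx := by
    rintro ⟨i, i'⟩ ⟨j, j'⟩
    simp only [LinearMap.pi_apply, LinearMap.comp_apply, TensorProduct.map_tmul,
      LinearMap.mul'_apply, LinearMap.proj_apply, e.coord_vec x hx.1, f.coord_vec x hx.2,
      Prod.mk.injEq]
    split_ifs <;> simp_all
  sum_coord x hx v := by
    induction v using TensorProduct.induction_on with
    | zero => simp
    | add v w hv hw =>
      conv_rhs => rw [← hv, ← hw]
      simp [add_smul, Finset.sum_add_distrib]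
    | tmul v w =>
      conv_rhs => rw [← e.sum_coord x hx.1 v, ← f.sum_coord x hx.2 w]
      rw [TensorProduct.sum_tmul, Fintype.sum_prod_type]
      refine Finset.sum_congr rfl fun i _ => ?_
      rw [TensorProduct.tmul_sum]
      refine Finset.sum_congr rfl fun j _ => ?_
      rw [TensorProduct.smul_tmul_smul]
      simp

end LocalFrame

namespace EquivariantFamily

/-- The direct sum `E ⊕ F`. -/
def sum (E F : EquivariantFamily V k H) : EquivariantFamily V k H where
  fib x := E.fib x × F.fib x
  act g _ _ h := (E.act g h).prodMap (F.act g h)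
  act_one h v := by simp [E.act_one, F.act_one]
  act_mul a b _ _ _ hb ha hab v := by
    simp [E.act_mul a b hb ha hab, F.act_mul a b hb ha hab]
  frames := {d | ∃ e ∈ E.frames, ∃ f ∈ F.frames, d = e.sum f}
  contMDiff_transition := by
    rintro _ ⟨e, he, f, hf, rfl⟩ _ ⟨e', he', f', hf', rfl⟩ (i | i) (j | j)
    · exact (E.contMDiff_transition e he e' he' i j).mono fun x hx => ⟨hx.1.1, hx.2.1⟩
    · exact (CkOn.const 0).congr fun x _ => congrFun (map_zero (f'.coord x)) j
    · exact (CkOn.const 0).congr fun x _ => congrFun (map_zero (e'.coord x)) j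
    · exact (F.contMDiff_transition f hf f' hf' i j).mono fun x hx => ⟨hx.1.2, hx.2.2⟩
  contMDiff_act := by
    rintro _ ⟨e, he, f, hf, rfl⟩ _ ⟨e', he', f', hf', rfl⟩ (i | i) (j | j)
    · exact (E.contMDiff_act e he e' he' i j).mono fun x hx => ⟨hx.1.1, hx.2.1⟩
    · exact (CkOn₂.const 0).congr fun x _ =>
        congrFun (map_zero ((f'.coord _).comp (F.act x.1 rfl))) j
    · exact (CkOn₂.const 0).congr fun x _ =>
        congrFun (map_zero ((e'.coord _).comp (E.act x.1 rfl))) j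
    · exact (F.contMDiff_act f hf f' hf' i j).mono fun x hx => ⟨hx.1.2, hx.2.2⟩

/-- The tensor product `E ⊗ F`. -/
noncomputable def tensor (E F : EquivariantFamily V k H) : EquivariantFamily V k H where
  fib x := E.fib x ⊗[ℂ] F.fib x
  act g _ _ h := TensorProduct.map (E.act g h) (F.act g h)
  act_one h v := by
    rw [show E.act 1 h = LinearMap.id from LinearMap.ext (E.act_one h),
      show F.act 1 h = LinearMap.id from LinearMap.ext (F.act_one h)]
    simp
  act_mul a b _ _ _ hb ha hab v := by
    rw [show E.act (a * b) hab = (E.act a ha).comp (E.act b hb) from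
        LinearMap.ext (E.act_mul a b hb ha hab),
      show F.act (a * b) hab = (F.act a ha).comp (F.act b hb) from
        LinearMap.ext (F.act_mul a b hb ha hab), TensorProduct.map_comp]
    rfl
  frames := {d | ∃ e ∈ E.frames, ∃ f ∈ F.frames, d = e.tensor f}
  contMDiff_transition := by
    rintro _ ⟨e, he, f, hf, rfl⟩ _ ⟨e', he', f', hf', rfl⟩ i j
    exact ((E.contMDiff_transition e he e' he' i.1 j.1).mono fun x hx => ⟨hx.1.1, hx.2.1⟩).mul
      ((F.contMDiff_transition f hf f' hf' i.2 j.2).mono fun x hx => ⟨hx.1.2, hx.2.2⟩)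
  contMDiff_act := by
    rintro _ ⟨e, he, f, hf, rfl⟩ _ ⟨e', he', f', hf', rfl⟩ i j
    exact ((E.contMDiff_act e he e' he' i.1 j.1).mono fun x hx => ⟨hx.1.1, hx.2.1⟩).mul
      ((F.contMDiff_act f hf f' hf' i.2 j.2).mono fun x hx => ⟨hx.1.2, hx.2.2⟩)

end EquivariantFamily

variable (H) in
/-- The global frame of the zero bundle. -/
def LocalFrame.zero : LocalFrame H (fun _ => PUnit.{u + 1}) where
  base := Set.univ
  isOpen_base := isOpen_univ
  ι := Empty
  vec _ i := i.elim
  coord _ := 0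
  coord_vec _ _ i := i.elim
  sum_coord _ _ _ := rfl

variable (H) in
/-- The global frame of the trivial line bundle. -/
def LocalFrame.one : LocalFrame H (fun _ => ULift.{u} ℂ) where
  base := Set.univ
  isOpen_base := isOpen_univ
  ι := Unit
  vec _ _ := ⟨1⟩
  coord _ := LinearMap.pi fun _ => (ULift.moduleEquiv : ULift.{u} ℂ ≃ₗ[ℂ] ℂ).toLinearMap
  coord_vec _ _ _ _ := by simp
  sum_coord _ _ v := by ext; simp

namespace GVectorBundle

/-- The direct sum of two `G`-vector bundles. -/
def sum (E F : GVectorBundle V k H) : GVectorBundle V k H where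
  toEquivariantFamily := E.toEquivariantFamily.sum F.toEquivariantFamily
  isLocallyTrivial x := by
    obtain ⟨e, he, hx⟩ := E.isLocallyTrivial x
    obtain ⟨f, hf, hx'⟩ := F.isLocallyTrivial x
    exact ⟨_, ⟨e, he, f, hf, rfl⟩, hx, hx'⟩

/-- The tensor product of two `G`-vector bundles. -/
noncomputable def tensor (E F : GVectorBundle V k H) : GVectorBundle V k H where
  toEquivariantFamily := E.toEquivariantFamily.tensor F.toEquivariantFamily
  isLocallyTrivial x := by
    obtain ⟨e, he, hx⟩ := E.isLocallyTrivial x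
    obtain ⟨f, hf, hx'⟩ := F.isLocallyTrivial x
    exact ⟨_, ⟨e, he, f, hf, rfl⟩, hx, hx'⟩

variable (V k H) in
/-- The zero bundle. -/
def zero : GVectorBundle V k H where
  fib _ := PUnit
  act _ _ _ _ := 0
  act_one _ _ := rfl
  act_mul _ _ _ _ _ _ _ _ _ := rfl
  frames := {LocalFrame.zero H}
  contMDiff_transition := by rintro _ rfl _ rfl i; exact i.elim
  contMDiff_act := by rintro _ rfl _ rfl i; exact i.elim
  isLocallyTrivial x := ⟨_, rfl, Set.mem_univ x⟩

variable (V k H) in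
/-- The trivial line bundle, with `G` acting trivially on the fibre `ℂ`. -/
def one : GVectorBundle V k H where
  fib _ := ULift.{u} ℂ
  act _ _ _ _ := LinearMap.id
  act_one _ _ := rfl
  act_mul _ _ _ _ _ _ _ _ _ := rfl
  frames := {LocalFrame.one H}
  contMDiff_transition := by rintro _ rfl _ rfl i j; exact CkOn.const 1
  contMDiff_act := by rintro _ rfl _ rfl i j; exact CkOn₂.const 1
  isLocallyTrivial x := ⟨_, rfl, Set.mem_univ x⟩

end GVectorBundle

theorem IsCkMap.sum {E E' F F' : EquivariantFamily V k H} {φ : ∀ x, E.fib x →ₗ[ℂ] E'.fib x}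
    {ψ : ∀ x, F.fib x →ₗ[ℂ] F'.fib x} (hφ : IsCkMap E E' φ) (hψ : IsCkMap F F' ψ) :
    IsCkMap (E.sum F) (E'.sum F') fun x => (φ x).prodMap (ψ x) := by
  rintro _ ⟨e, he, f, hf, rfl⟩ _ ⟨e', he', f', hf', rfl⟩ (i | i) (j | j)
  · exact (hφ e he e' he' i j).mono fun x hx => ⟨hx.1.1, hx.2.1⟩
  · exact (CkOn.const 0).congr fun x _ => congrFun (map_zero ((f'.coord x).comp (ψ x))) j
  · exact (CkOn.const 0).congr fun x _ => congrFun (map_zero ((e'.coord x).comp (φ x))) j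
  · exact (hψ f hf f' hf' i j).mono fun x hx => ⟨hx.1.2, hx.2.2⟩

theorem IsCkMap.tensor {E E' F F' : EquivariantFamily V k H} {φ : ∀ x, E.fib x →ₗ[ℂ] E'.fib x}
    {ψ : ∀ x, F.fib x →ₗ[ℂ] F'.fib x} (hφ : IsCkMap E E' φ) (hψ : IsCkMap F F' ψ) :
    IsCkMap (E.tensor F) (E'.tensor F') fun x => TensorProduct.map (φ x) (ψ x) := by
  rintro _ ⟨e, he, f, hf, rfl⟩ _ ⟨e', he', f', hf', rfl⟩ i j
  exact ((hφ e he e' he' i.1 j.1).mono fun x hx => ⟨hx.1.1, hx.2.1⟩).mul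
    ((hψ f hf f' hf' i.2 j.2).mono fun x hx => ⟨hx.1.2, hx.2.2⟩)

namespace GIso
variable {E E' F F' : EquivariantFamily V k H}

/-- Direct sums respect isomorphisms. -/
def sum (φ : GIso E E') (ψ : GIso F F') : GIso (E.sum F) (E'.sum F') where
  toEquiv x := (φ.toEquiv x).prodCongr (ψ.toEquiv x)
  map_act g _ _ h v := Prod.ext (φ.map_act g h v.1) (ψ.map_act g h v.2)
  isCkMap := φ.isCkMap.sum ψ.isCkMap
  isCkMap_symm := φ.isCkMap_symm.sum ψ.isCkMap_symm

/-- Tensor products respect isomorphisms. -/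
noncomputable def tensor (φ : GIso E E') (ψ : GIso F F') : GIso (E.tensor F) (E'.tensor F') where
  toEquiv x := TensorProduct.congr (φ.toEquiv x) (ψ.toEquiv x)
  map_act g x y h v := LinearMap.congr_fun (show
    TensorProduct.map (φ.toEquiv y).toLinearMap (ψ.toEquiv y).toLinearMap ∘ₗ
      TensorProduct.map (E.act g h) (F.act g h) =
    TensorProduct.map (E'.act g h) (F'.act g h) ∘ₗ
      TensorProduct.map (φ.toEquiv x).toLinearMap (ψ.toEquiv x).toLinearMap from
    TensorProduct.ext' fun v w => by simp [φ.map_act, ψ.map_act]) v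
  isCkMap := φ.isCkMap.tensor ψ.isCkMap
  isCkMap_symm := φ.isCkMap_symm.tensor ψ.isCkMap_symm

end GIso

variable (V k H) in
/-- Two bundles are equivalent if they are `G`-isomorphic. -/
instance GVectorBundle.setoid : Setoid (GVectorBundle V k H) where
  r E F := Nonempty (GIso E.toEquivariantFamily F.toEquivariantFamily)
  iseqv :=
    { refl := fun _ => ⟨GIso.refl _⟩
      symm := fun ⟨φ⟩ => ⟨φ.symm⟩
      trans := fun {_ F _} ⟨φ⟩ ⟨ψ⟩ => ⟨φ.trans F.isLocallyTrivial ψ⟩ }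

variable (V k H) in
/-- `Vect_G(G/H)`: the `G`-isomorphism classes of `G`-vector bundles over `G/H`. -/
def Vect : Type _ := Quotient (GVectorBundle.setoid V k H)

/-- The isomorphism class of a bundle. -/
def Vect.mk (E : GVectorBundle V k H) : Vect V k H := Quotient.mk _ E

namespace Vect

theorem mk_eq {E F : GVectorBundle V k H}
    (φ : GIso E.toEquivariantFamily F.toEquivariantFamily) : mk E = mk F := Quotient.sound ⟨φ⟩

instance : Zero (Vect V k H) := ⟨mk (GVectorBundle.zero V k H)⟩
instance : One (Vect V k H) := ⟨mk (GVectorBundle.one V k H)⟩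
instance : Add (Vect V k H) :=
  ⟨Quotient.map₂ GVectorBundle.sum fun _ _ ⟨φ⟩ _ _ ⟨ψ⟩ => ⟨φ.sum ψ⟩⟩
noncomputable instance : Mul (Vect V k H) :=
  ⟨Quotient.map₂ GVectorBundle.tensor fun _ _ ⟨φ⟩ _ _ ⟨ψ⟩ => ⟨φ.tensor ψ⟩⟩

theorem mk_add (E F : GVectorBundle V k H) : mk E + mk F = mk (E.sum F) := rfl
theorem mk_mul (E F : GVectorBundle V k H) : mk E * mk F = mk (E.tensor F) := rfl

protected theorem add_comm (a b : Vect V k H) : a + b = b + a := by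
  induction a using Quotient.ind; rename_i E
  induction b using Quotient.ind; rename_i F
  refine mk_eq (GIso.ofMatching (fun x => LinearEquiv.prodComm ℂ (E.fib x) (F.fib x))
    (fun _ _ _ _ _ => rfl) fun x => ?_)
  obtain ⟨e, he, hx⟩ := E.isLocallyTrivial x
  obtain ⟨f, hf, hx'⟩ := F.isLocallyTrivial x
  refine ⟨_, ⟨e, he, f, hf, rfl⟩, _, ⟨f, hf, e, he, rfl⟩, ⟨hx, hx'⟩, ⟨hx', hx⟩,
    Equiv.sumComm _ _, fun y _ _ => ?_⟩
  rintro (i | i) <;> rfl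

protected theorem add_assoc (a b c : Vect V k H) : a + b + c = a + (b + c) := by
  induction a using Quotient.ind; rename_i E
  induction b using Quotient.ind; rename_i F
  induction c using Quotient.ind; rename_i K
  refine mk_eq (GIso.ofMatching
    (fun x => LinearEquiv.prodAssoc ℂ (E.fib x) (F.fib x) (K.fib x))
    (fun _ _ _ _ _ => rfl) fun x => ?_)
  obtain ⟨e, he, hx⟩ := E.isLocallyTrivial x
  obtain ⟨f, hf, hx'⟩ := F.isLocallyTrivial x
  obtain ⟨d, hd, hx''⟩ := K.isLocallyTrivial x
  refine ⟨_, ⟨_, ⟨e, he, f, hf, rfl⟩, d, hd, rfl⟩, _, ⟨e, he, _, ⟨f, hf, d, hd, rfl⟩, rfl⟩,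
    ⟨⟨hx, hx'⟩, hx''⟩, ⟨hx, hx', hx''⟩, Equiv.sumAssoc _ _ _, fun y _ _ => ?_⟩
  rintro ((i | i) | i) <;> rfl

protected theorem zero_add (a : Vect V k H) : 0 + a = a := by
  induction a using Quotient.ind; rename_i E
  refine mk_eq (GIso.ofMatching (fun x => LinearEquiv.uniqueProd (R := ℂ) (M := E.fib x)
    (M₂ := PUnit.{u + 1})) (fun _ _ _ _ _ => rfl) fun x => ?_)
  obtain ⟨e, he, hx⟩ := E.isLocallyTrivial x
  refine ⟨_, ⟨_, rfl, e, he, rfl⟩, e, he, ⟨Set.mem_univ _, hx⟩, hx, Equiv.emptySum Empty _,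
    fun y _ _ => ?_⟩
  rintro (i | i)
  · exact i.elim
  · rfl

protected theorem mul_comm (a b : Vect V k H) : a * b = b * a := by
  induction a using Quotient.ind; rename_i E
  induction b using Quotient.ind; rename_i F
  refine mk_eq (GIso.ofMatching (fun x => TensorProduct.comm ℂ (E.fib x) (F.fib x))
    (fun g x y h => LinearMap.congr_fun (show
      (TensorProduct.comm ℂ (E.fib y) (F.fib y)).toLinearMap ∘ₗ
        TensorProduct.map (E.act g h) (F.act g h) =
      TensorProduct.map (F.act g h) (E.act g h) ∘ₗ
        (TensorProduct.comm ℂ (E.fib x) (F.fib x)).toLinearMap from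
      TensorProduct.ext' fun _ _ => rfl)) fun x => ?_)
  obtain ⟨e, he, hx⟩ := E.isLocallyTrivial x
  obtain ⟨f, hf, hx'⟩ := F.isLocallyTrivial x
  exact ⟨_, ⟨e, he, f, hf, rfl⟩, _, ⟨f, hf, e, he, rfl⟩, ⟨hx, hx'⟩, ⟨hx', hx⟩,
    Equiv.prodComm _ _, fun y _ _ _ => rfl⟩

protected theorem mul_assoc (a b c : Vect V k H) : a * b * c = a * (b * c) := by
  induction a using Quotient.ind; rename_i E
  induction b using Quotient.ind; rename_i F
  induction c using Quotient.ind; rename_i K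
  refine mk_eq (GIso.ofMatching
    (fun x => TensorProduct.assoc ℂ (E.fib x) (F.fib x) (K.fib x))
    (fun g x y h => LinearMap.congr_fun (show
      (TensorProduct.assoc ℂ (E.fib y) (F.fib y) (K.fib y)).toLinearMap ∘ₗ
        TensorProduct.map (TensorProduct.map (E.act g h) (F.act g h)) (K.act g h) =
      TensorProduct.map (E.act g h) (TensorProduct.map (F.act g h) (K.act g h)) ∘ₗ
        (TensorProduct.assoc ℂ (E.fib x) (F.fib x) (K.fib x)).toLinearMap from
      TensorProduct.ext_threefold fun _ _ _ => rfl)) fun x => ?_)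
  obtain ⟨e, he, hx⟩ := E.isLocallyTrivial x
  obtain ⟨f, hf, hx'⟩ := F.isLocallyTrivial x
  obtain ⟨d, hd, hx''⟩ := K.isLocallyTrivial x
  exact ⟨_, ⟨_, ⟨e, he, f, hf, rfl⟩, d, hd, rfl⟩, _, ⟨e, he, _, ⟨f, hf, d, hd, rfl⟩, rfl⟩,
    ⟨⟨hx, hx'⟩, hx''⟩, ⟨hx, hx', hx''⟩, Equiv.prodAssoc _ _ _, fun y _ _ _ => rfl⟩

protected theorem one_mul (a : Vect V k H) : 1 * a = a := by
  induction a using Quotient.ind; rename_i E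
  refine mk_eq (GIso.ofMatching (fun x => (TensorProduct.congr
    (ULift.moduleEquiv : ULift.{u} ℂ ≃ₗ[ℂ] ℂ) (LinearEquiv.refl ℂ (E.fib x))).trans
      (TensorProduct.lid ℂ (E.fib x)))
    (fun g x y h => LinearMap.congr_fun (show
      ((TensorProduct.congr (ULift.moduleEquiv : ULift.{u} ℂ ≃ₗ[ℂ] ℂ)
        (LinearEquiv.refl ℂ (E.fib y))).trans (TensorProduct.lid ℂ (E.fib y))).toLinearMap ∘ₗ
        TensorProduct.map LinearMap.id (E.act g h) =
      E.act g h ∘ₗ ((TensorProduct.congr (ULift.moduleEquiv : ULift.{u} ℂ ≃ₗ[ℂ] ℂ)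
        (LinearEquiv.refl ℂ (E.fib x))).trans (TensorProduct.lid ℂ (E.fib x))).toLinearMap from
      TensorProduct.ext' fun _ _ => by simp)) fun x => ?_)
  obtain ⟨e, he, hx⟩ := E.isLocallyTrivial x
  exact ⟨_, ⟨_, rfl, e, he, rfl⟩, e, he, ⟨Set.mem_univ _, hx⟩, hx, Equiv.punitProd _,
    fun y _ _ i => one_smul ℂ (e.vec y i.2)⟩

protected theorem zero_mul (a : Vect V k H) : 0 * a = 0 := by
  induction a using Quotient.ind; rename_i E
  have hs : ∀ x, Subsingleton (PUnit.{u + 1} ⊗[ℂ] E.fib x) := fun x =>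
    ⟨fun v w => by
      have : ∀ v : PUnit.{u + 1} ⊗[ℂ] E.fib x, v = 0 := fun v => by
        induction v using TensorProduct.induction_on with
        | zero => rfl
        | add v w hv hw => rw [hv, hw, add_zero]
        | tmul v w => exact TensorProduct.zero_tmul _ w
      rw [this v, this w]⟩
  refine mk_eq (GIso.ofMatching (fun x => (LinearEquiv.ofSubsingleton
    (PUnit.{u + 1} ⊗[ℂ] E.fib x) PUnit.{u + 1})) (fun _ _ _ _ _ => rfl) fun x => ?_)
  obtain ⟨e, he, hx⟩ := E.isLocallyTrivial x
  exact ⟨_, ⟨_, rfl, e, he, rfl⟩, _, rfl, ⟨Set.mem_univ _, hx⟩, Set.mem_univ _,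
    (Equiv.equivOfIsEmpty (Empty × e.ι) Empty), fun y _ _ i => rfl⟩

protected theorem mul_add (a b c : Vect V k H) : a * (b + c) = a * b + a * c := by
  induction a using Quotient.ind; rename_i E
  induction b using Quotient.ind; rename_i F
  induction c using Quotient.ind; rename_i K
  refine mk_eq (GIso.ofMatching
    (fun x => TensorProduct.prodRight ℂ ℂ (E.fib x) (F.fib x) (K.fib x))
    (fun g x y h => LinearMap.congr_fun (show
      (TensorProduct.prodRight ℂ ℂ (E.fib y) (F.fib y) (K.fib y)).toLinearMap ∘ₗ
        TensorProduct.map (E.act g h) ((F.act g h).prodMap (K.act g h)) =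
      ((TensorProduct.map (E.act g h) (F.act g h)).prodMap
        (TensorProduct.map (E.act g h) (K.act g h))) ∘ₗ
        (TensorProduct.prodRight ℂ ℂ (E.fib x) (F.fib x) (K.fib x)).toLinearMap from
      TensorProduct.ext' fun _ _ => rfl)) fun x => ?_)
  obtain ⟨e, he, hx⟩ := E.isLocallyTrivial x
  obtain ⟨f, hf, hx'⟩ := F.isLocallyTrivial x
  obtain ⟨d, hd, hx''⟩ := K.isLocallyTrivial x
  refine ⟨_, ⟨e, he, _, ⟨f, hf, d, hd, rfl⟩, rfl⟩, _,
    ⟨_, ⟨e, he, f, hf, rfl⟩, _, ⟨e, he, d, hd, rfl⟩, rfl⟩,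
    ⟨hx, hx', hx''⟩, ⟨⟨hx, hx'⟩, hx, hx''⟩, Equiv.prodSumDistrib _ _ _, fun y _ _ => ?_⟩
  rintro ⟨i, j | j⟩
  · exact Prod.ext rfl (TensorProduct.tmul_zero _ (e.vec y i))
  · exact Prod.ext (TensorProduct.tmul_zero _ (e.vec y i)) rfl

/-- Direct sum and tensor product make the isomorphism classes into a commutative semiring. -/
noncomputable instance : CommSemiring (Vect V k H) where
  add_assoc := Vect.add_assoc
  zero_add := Vect.zero_add
  add_zero a := (Vect.add_comm a 0).trans (Vect.zero_add a)
  add_comm := Vect.add_comm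
  nsmul := nsmulRec
  mul_assoc := Vect.mul_assoc
  one_mul := Vect.one_mul
  mul_one a := (Vect.mul_comm a 1).trans (Vect.one_mul a)
  zero_mul := Vect.zero_mul
  mul_zero a := (Vect.mul_comm a 0).trans (Vect.zero_mul a)
  left_distrib := Vect.mul_add
  right_distrib a b c := by
    rw [Vect.mul_comm, Vect.mul_add, Vect.mul_comm c a, Vect.mul_comm c b]
  mul_comm := Vect.mul_comm

end Vect

end Operations
end Bundles

section Representations

/-- A finite-dimensional complex `H`-module: a finite-dimensional complex representation whose
matrix coefficients are continuous, i.e. a continuous homomorphism from `H` to `GL(M)`. -/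
structure FinRep (H : Type u) [Group H] [TopologicalSpace H] where
  carrier : Type u
  [addCommGroup : AddCommGroup carrier]
  [module : Module ℂ carrier]
  [finite : Module.Finite ℂ carrier]
  ρ : Representation ℂ H carrier
  continuous_coeff : ∀ (v : carrier) (l : Dual ℂ carrier), Continuous fun h => l (ρ h v)

attribute [instance] FinRep.addCommGroup FinRep.module FinRep.finite

variable {H : Type u} [Group H] [TopologicalSpace H]

namespace FinRep

/-- The direct sum. -/
noncomputable def sum (M N : FinRep H) : FinRep H where
  carrier := M.carrier × N.carrier
  ρ := M.ρ.prod N.ρ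
  continuous_coeff v l := by
    have h1 := M.continuous_coeff v.1 (l.comp (LinearMap.inl ℂ M.carrier N.carrier))
    have h2 := N.continuous_coeff v.2 (l.comp (LinearMap.inr ℂ M.carrier N.carrier))
    refine (h1.add h2).congr fun h => ?_
    exact (map_add l (M.ρ h v.1, 0) (0, N.ρ h v.2)).symm.trans
      (congrArg l (Prod.ext (add_zero _) (zero_add _)))

theorem continuous_tensor (M N : FinRep H) (t : M.carrier ⊗[ℂ] N.carrier)
    (l : Dual ℂ (M.carrier ⊗[ℂ] N.carrier)) :
    Continuous fun h => l (TensorProduct.map (M.ρ h) (N.ρ h) t) := by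
  induction t using TensorProduct.induction_on with
  | zero => simpa using continuous_const
  | add v w hv hw => exact (hv.add hw).congr fun h => by simp
  | tmul v w =>
    let b := Module.finBasis ℂ M.carrier
    let c := Module.finBasis ℂ N.carrier
    have : ∀ h, l (TensorProduct.map (M.ρ h) (N.ρ h) (v ⊗ₜ w)) =
        ∑ i, ∑ j, b.coord i (M.ρ h v) * (c.coord j (N.ρ h w) * l (b i ⊗ₜ c j)) := by
      intro h
      rw [TensorProduct.map_tmul]
      generalize M.ρ h v = v'
      generalize N.ρ h w = w'
      conv_lhs => rw [← b.sum_repr v', ← c.sum_repr w']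
      rw [TensorProduct.sum_tmul, map_sum]
      refine Finset.sum_congr rfl fun i _ => ?_
      rw [TensorProduct.tmul_sum, map_sum]
      refine Finset.sum_congr rfl fun j _ => ?_
      rw [TensorProduct.smul_tmul_smul, map_smul]
      simp [mul_assoc]
    simp only [this]
    exact continuous_finsetSum _ fun i _ => continuous_finsetSum _ fun j _ =>
      (M.continuous_coeff v _).mul ((N.continuous_coeff w _).mul continuous_const)

/-- The tensor product, with the diagonal action. -/
noncomputable def tensor (M N : FinRep H) : FinRep H where
  carrier := M.carrier ⊗[ℂ] N.carrier
  ρ := M.ρ.tprod N.ρ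
  continuous_coeff := continuous_tensor M N

variable (H) in
/-- The zero representation. -/
abbrev zero : FinRep H where
  carrier := PUnit
  ρ := 1
  continuous_coeff v l := (continuous_const (y := l v)).congr fun _ => rfl

variable (H) in
/-- The trivial representation on `ℂ`. -/
abbrev one : FinRep H where
  carrier := ULift.{u} ℂ
  ρ := 1
  continuous_coeff v l := (continuous_const (y := l v)).congr fun _ => rfl

variable (H) in
/-- Two representations are equivalent if they are isomorphic. -/
instance setoid : Setoid (FinRep H) where
  r M N := Nonempty (M.ρ.Equiv N.ρ)
  iseqv :=
    { refl := fun _ => ⟨Representation.Equiv.refl _⟩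
      symm := fun ⟨φ⟩ => ⟨φ.symm⟩
      trans := fun ⟨φ⟩ ⟨ψ⟩ => ⟨φ.trans ψ⟩ }

end FinRep

variable (H) in
/-- The isomorphism classes of finite-dimensional complex `H`-modules. -/
def RepClass : Type _ := Quotient (FinRep.setoid H)

/-- The isomorphism class of a representation. -/
def RepClass.mk (M : FinRep H) : RepClass H := Quotient.mk _ M

namespace RepClass

theorem mk_eq {M N : FinRep H} (e : M.carrier ≃ₗ[ℂ] N.carrier)
    (he : ∀ h, e.toLinearMap ∘ₗ M.ρ h = N.ρ h ∘ₗ e.toLinearMap) : mk M = mk N :=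
  Quotient.sound ⟨Representation.Equiv.mk e he⟩

theorem equiv_comm {M N : FinRep H} (φ : M.ρ.Equiv N.ρ) (h : H) :
    φ.toLinearEquiv.toLinearMap ∘ₗ M.ρ h = N.ρ h ∘ₗ φ.toLinearEquiv.toLinearMap :=
  φ.toIntertwiningMap.isIntertwining' h

instance : Zero (RepClass H) := ⟨mk (FinRep.zero H)⟩
instance : One (RepClass H) := ⟨mk (FinRep.one H)⟩
noncomputable instance : Add (RepClass H) :=
  ⟨Quotient.map₂ FinRep.sum fun _ _ ⟨φ⟩ _ _ ⟨ψ⟩ =>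
    ⟨Representation.Equiv.mk (φ.toLinearEquiv.prodCongr ψ.toLinearEquiv) fun h =>
      LinearMap.ext fun v => Prod.ext (LinearMap.congr_fun (equiv_comm φ h) v.1)
        (LinearMap.congr_fun (equiv_comm ψ h) v.2)⟩⟩
noncomputable instance : Mul (RepClass H) :=
  ⟨Quotient.map₂ FinRep.tensor fun _ _ ⟨φ⟩ _ _ ⟨ψ⟩ =>
    ⟨Representation.Equiv.mk (TensorProduct.congr φ.toLinearEquiv ψ.toLinearEquiv) fun h =>
      TensorProduct.ext' fun v w => congrArg₂ (· ⊗ₜ[ℂ] ·)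
        (LinearMap.congr_fun (equiv_comm φ h) v) (LinearMap.congr_fun (equiv_comm ψ h) w)⟩⟩

theorem mk_add (M N : FinRep H) : mk M + mk N = mk (M.sum N) := rfl
theorem mk_mul (M N : FinRep H) : mk M * mk N = mk (M.tensor N) := rfl

protected theorem add_comm (a b : RepClass H) : a + b = b + a := by
  induction a using Quotient.ind; rename_i M
  induction b using Quotient.ind; rename_i N
  exact mk_eq (M := M.sum N) (N := N.sum M) (LinearEquiv.prodComm ℂ M.carrier N.carrier)
    fun h => rfl

protected theorem add_assoc (a b c : RepClass H) : a + b + c = a + (b + c) := by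
  induction a using Quotient.ind; rename_i M
  induction b using Quotient.ind; rename_i N
  induction c using Quotient.ind; rename_i K
  exact mk_eq (M := (M.sum N).sum K) (N := M.sum (N.sum K))
    (LinearEquiv.prodAssoc ℂ M.carrier N.carrier K.carrier) fun h => rfl

protected theorem zero_add (a : RepClass H) : 0 + a = a := by
  induction a using Quotient.ind; rename_i M
  exact mk_eq (M := (FinRep.zero H).sum M) (N := M)
    (LinearEquiv.uniqueProd (R := ℂ) (M := M.carrier) (M₂ := PUnit.{u + 1})) fun h => rfl

protected theorem mul_comm (a b : RepClass H) : a * b = b * a := by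
  induction a using Quotient.ind; rename_i M
  induction b using Quotient.ind; rename_i N
  exact mk_eq (M := M.tensor N) (N := N.tensor M) (TensorProduct.comm ℂ M.carrier N.carrier)
    fun h => TensorProduct.ext' fun _ _ => rfl

protected theorem mul_assoc (a b c : RepClass H) : a * b * c = a * (b * c) := by
  induction a using Quotient.ind; rename_i M
  induction b using Quotient.ind; rename_i N
  induction c using Quotient.ind; rename_i K
  exact mk_eq (M := (M.tensor N).tensor K) (N := M.tensor (N.tensor K))
    (TensorProduct.assoc ℂ M.carrier N.carrier K.carrier)
    fun h => TensorProduct.ext_threefold fun _ _ _ => rfl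

protected theorem one_mul (a : RepClass H) : 1 * a = a := by
  induction a using Quotient.ind; rename_i M
  refine mk_eq (M := (FinRep.one H).tensor M) (N := M)
    ((TensorProduct.congr (ULift.moduleEquiv : ULift.{u} ℂ ≃ₗ[ℂ] ℂ)
      (LinearEquiv.refl ℂ M.carrier)).trans (TensorProduct.lid ℂ M.carrier))
    fun h => TensorProduct.ext' fun c v => ?_
  exact (map_smul (M.ρ h) c.down v).symm

protected theorem zero_mul (a : RepClass H) : 0 * a = 0 := by
  induction a using Quotient.ind; rename_i M
  have : Subsingleton (PUnit.{u + 1} ⊗[ℂ] M.carrier) :=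
    ⟨fun v w => by
      have : ∀ v : PUnit.{u + 1} ⊗[ℂ] M.carrier, v = 0 := fun v => by
        induction v using TensorProduct.induction_on with
        | zero => rfl
        | add v w hv hw => rw [hv, hw, add_zero]
        | tmul v w => exact TensorProduct.zero_tmul _ w
      rw [this v, this w]⟩
  exact mk_eq (M := (FinRep.zero H).tensor M) (N := FinRep.zero H)
    (LinearEquiv.ofSubsingleton (PUnit.{u + 1} ⊗[ℂ] M.carrier) PUnit.{u + 1}) fun h => rfl

protected theorem mul_add (a b c : RepClass H) : a * (b + c) = a * b + a * c := by
  induction a using Quotient.ind; rename_i M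
  induction b using Quotient.ind; rename_i N
  induction c using Quotient.ind; rename_i K
  exact mk_eq (M := M.tensor (N.sum K)) (N := (M.tensor N).sum (M.tensor K))
    (TensorProduct.prodRight ℂ ℂ M.carrier N.carrier K.carrier)
    fun h => TensorProduct.ext' fun _ _ => rfl

/-- Direct sum and tensor product make the isomorphism classes into a commutative semiring. -/
noncomputable instance : CommSemiring (RepClass H) where
  add_assoc := RepClass.add_assoc
  zero_add := RepClass.zero_add
  add_zero a := (RepClass.add_comm a 0).trans (RepClass.zero_add a)
  add_comm := RepClass.add_comm
  nsmul := nsmulRec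
  mul_assoc := RepClass.mul_assoc
  one_mul := RepClass.one_mul
  mul_one a := (RepClass.mul_comm a 1).trans (RepClass.one_mul a)
  zero_mul := RepClass.zero_mul
  mul_zero a := (RepClass.mul_comm a 0).trans (RepClass.zero_mul a)
  left_distrib := RepClass.mul_add
  right_distrib a b c := by
    rw [RepClass.mul_comm, RepClass.mul_add, RepClass.mul_comm c a, RepClass.mul_comm c b]
  mul_comm := RepClass.mul_comm

end RepClass

variable (H) in
/-- The representation ring `R(H)`. -/
abbrev RepRing : Type _ := GrothendieckRing (RepClass H)

/-- The class `[M] ∈ R(H)`. -/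
noncomputable def RepRing.mk (M : FinRep H) : RepRing H := GrothendieckRing.of (RepClass.mk M)

end Representations

section Associated

variable {V : Type v} [NormedAddCommGroup V] [NormedSpace ℝ V]
  {G : Type u} [TopologicalSpace G] [Group G] [ChartedSpace V G] {k : ℕ∞} {H : Subgroup G}

variable (V k H) in
/-- `K_G(G/H)`, for `G`-vector bundles of class `C^k`. -/
abbrev KG : Type _ := GrothendieckRing (Vect V k H)

/-- The class `[E] ∈ K_G(G/H)`. -/
noncomputable def KG.mk (E : GVectorBundle V k H) : KG V k H := GrothendieckRing.of (Vect.mk E)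

/-! ### The fibre over the identity coset -/

theorem smul_identityCoset (h : H) :
    (h : G) • ((1 : G) : G ⧸ H) = ((1 : G) : G ⧸ H) := by
  change (((h : G) * 1 : G) : G ⧸ H) = _
  rw [QuotientGroup.eq]
  simp

theorem smul_identityCoset' (g : G) : g • ((1 : G) : G ⧸ H) = (g : G ⧸ H) := by
  change ((g * 1 : G) : G ⧸ H) = _
  rw [mul_one]

theorem EquivariantFamily.coord_act_congr (E : EquivariantFamily V k H)
    (e : LocalFrame H E.fib) (g : G) {x y : G ⧸ H} (h : g • x = y) (v : E.fib x) (j : e.ι) :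
    e.coord y (E.act g h v) j = e.coord (g • x) (E.act g rfl v) j := by
  subst h; rfl

/-- The fibre of a `G`-vector bundle over the identity coset `H`, with the action of `H`. -/
def GVectorBundle.fibreRep (E : GVectorBundle V k H) : FinRep H where
  carrier := E.fib ((1 : G) : G ⧸ H)
  finite := by
    obtain ⟨e, -, hx⟩ := E.isLocallyTrivial ((1 : G) : G ⧸ H)
    exact Module.Finite.of_injective (e.coord _) fun v w h => by
      rw [← e.sum_coord _ hx v, ← e.sum_coord _ hx w, h]
  ρ :=
    { toFun := fun h => E.act (h : G) (smul_identityCoset h)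
      map_one' := LinearMap.ext (E.act_one _)
      map_mul' := fun a b => LinearMap.ext (E.act_mul a b _ _ _) }
  continuous_coeff v l := by
    obtain ⟨e, he, hx⟩ := E.isLocallyTrivial ((1 : G) : G ⧸ H)
    have key : ∀ i j, Continuous fun h : H => e.coord ((1 : G) : G ⧸ H)
        (E.act (h : G) (smul_identityCoset h) (e.vec ((1 : G) : G ⧸ H) i)) j := by
      intro i j
      have h1 := ContMDiffOn.continuousOn (E.contMDiff_act e he e he i j)
      have h2 : Continuous fun h : H => ((h : G), (1 : G)) := by fun_prop
      refine (h1.comp_continuous h2 fun h => ⟨hx, ?_⟩).congr fun h => ?_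
      · change (((h : G) * 1 : G) : G ⧸ H) ∈ e.base
        have := smul_identityCoset h
        change (((h : G) * 1 : G) : G ⧸ H) = _ at this
        rwa [this]
      · exact (E.coord_act_congr e _ (smul_identityCoset h) _ j).symm
    have : ∀ h : H, l (E.act (h : G) (smul_identityCoset h) v) =
        ∑ i, e.coord _ v i * ∑ j, e.coord ((1 : G) : G ⧸ H)
          (E.act (h : G) (smul_identityCoset h) (e.vec ((1 : G) : G ⧸ H) i)) j *
            l (e.vec _ j) := by
      intro h
      refine (e.map_eq hx (l.comp (E.act (h : G) (smul_identityCoset h))) v).trans ?_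
      refine Finset.sum_congr rfl fun i _ => ?_
      rw [LinearMap.comp_apply, e.map_eq hx l]
      rfl
    refine (Continuous.congr ?_ fun h => (this h).symm)
    exact continuous_finsetSum _ fun i _ => continuous_const.mul
      (continuous_finsetSum _ fun j _ => (key i j).mul continuous_const)

/-! ### The associated bundle -/

/-- The relation `(g, m) ∼ (g h⁻¹, h m)` on `G × M`. -/
def assocSetoid (M : FinRep H) : Setoid (G × M.carrier) where
  r p q := ∃ h : H, q = (p.1 * (h : G)⁻¹, M.ρ h p.2)
  iseqv :=
    { refl := fun p => ⟨1, by simp⟩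
      symm := by
        rintro ⟨g, m⟩ _ ⟨h, rfl⟩
        exact ⟨h⁻¹, by simp⟩
      trans := by
        rintro ⟨g, m⟩ _ _ ⟨h, rfl⟩ ⟨h', rfl⟩
        exact ⟨h' * h, by simp [mul_assoc]⟩ }

/-- The total space `G ×_H M`. -/
def Assoc (M : FinRep H) : Type u := Quotient (assocSetoid M)

namespace Assoc
variable (M : FinRep H)

/-- The class `[g, m] ∈ G ×_H M`. -/
def mk (g : G) (m : M.carrier) : Assoc M := Quotient.mk (assocSetoid M) (g, m)

variable {M}

theorem mk_eq_mk {g g' : G} {m m' : M.carrier} :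
    mk M g m = mk M g' m' ↔ ∃ h : H, (g', m') = (g * (h : G)⁻¹, M.ρ h m) :=
  Quotient.eq (r := assocSetoid M)

theorem mk_mul (g : G) (h : H) (m : M.carrier) : mk M (g * h) m = mk M g (M.ρ h m) :=
  mk_eq_mk.2 ⟨h, by simp⟩

/-- The projection `[g, m] ↦ g H`. -/
def proj : Assoc M → G ⧸ H :=
  Quotient.lift (fun p => (p.1 : G ⧸ H)) (by
    rintro ⟨g, m⟩ _ ⟨h, rfl⟩
    simp)

/-- The action `a • [g, m] = [a g, m]`. -/
def smul (a : G) : Assoc M → Assoc M :=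
  Quotient.map (fun p => (a * p.1, p.2)) (by
    rintro ⟨g, m⟩ _ ⟨h, rfl⟩
    exact ⟨h, by simp [mul_assoc]⟩)

theorem smul_mk (a g : G) (m : M.carrier) : smul a (mk M g m) = mk M (a * g) m := rfl

theorem proj_smul (a : G) (z : Assoc M) : proj (smul a z) = a • proj z := by
  induction z using Quotient.ind; rfl

variable (M) in
/-- The fibre of `G ×_H M → G/H` over `x`. -/
def Fibre (x : G ⧸ H) : Type u := {z : Assoc M // proj z = x}

/-- The bijection `m ↦ [g, m]` from `M` to the fibre over `g H`. -/
noncomputable def fibreEquiv (g : G) {x : G ⧸ H} (hg : (g : G ⧸ H) = x) :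
    M.carrier ≃ Fibre M x :=
  Equiv.ofBijective (fun m => ⟨mk M g m, hg⟩) <| by
    constructor
    · intro m m' h
      obtain ⟨h, hh⟩ := mk_eq_mk.1 (Subtype.ext_iff.1 h)
      obtain ⟨h1, h2⟩ := Prod.ext_iff.1 hh
      have : h = 1 := by
        have : (h : G) = 1 := by simpa using h1
        exact_mod_cast this
      subst this
      simpa using h2.symm
    · rintro ⟨z, hz⟩
      induction z using Quotient.ind
      rename_i p
      obtain ⟨g', m⟩ := p
      have hmem : g⁻¹ * g' ∈ H := QuotientGroup.eq.1 (hg.trans hz.symm)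
      refine ⟨M.ρ ⟨g⁻¹ * g', hmem⟩ m, Subtype.ext ?_⟩
      change mk M g _ = mk M g' m
      rw [← mk_mul]
      simp

theorem fibreEquiv_coe (g : G) {x : G ⧸ H} (hg : (g : G ⧸ H) = x) (m : M.carrier) :
    (fibreEquiv g hg m).1 = mk M g m := rfl

/-- The fibres are vector spaces, with `[g, m] + [g, m'] = [g, m + m']` and
`c [g, m] = [g, c m]`; see `fibreLin`. -/
noncomputable instance (x : G ⧸ H) : AddCommGroup (Fibre M x) :=
  (fibreEquiv (M := M) x.out (QuotientGroup.out_eq' x)).symm.addCommGroup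

noncomputable instance (x : G ⧸ H) : Module ℂ (Fibre M x) :=
  (fibreEquiv (M := M) x.out (QuotientGroup.out_eq' x)).symm.module ℂ

variable (M) in
/-- The linear isomorphism `m ↦ [g, m]` from `M` to the fibre over `g H`, for every `g`. -/
noncomputable def fibreLin (g : G) {x : G ⧸ H} (hg : (g : G ⧸ H) = x) :
    M.carrier ≃ₗ[ℂ] Fibre M x :=
  have hmem : x.out⁻¹ * g ∈ H := QuotientGroup.eq.1 ((QuotientGroup.out_eq' x).trans hg.symm)
  have key : ∀ m, fibreEquiv g hg m =
      ((fibreEquiv (M := M) x.out (QuotientGroup.out_eq' x)).symm.linearEquiv ℂ).symm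
        (M.ρ ⟨x.out⁻¹ * g, hmem⟩ m) := fun m => Subtype.ext <| by
    change mk M g m = mk M x.out _
    rw [← mk_mul]
    simp
  { fibreEquiv g hg with
    map_add' := fun m m' => by
      simp only [Equiv.toFun_as_coe, key, map_add]
    map_smul' := fun c m => by
      simp only [Equiv.toFun_as_coe, key, map_smul, RingHom.id_apply] }

theorem fibreLin_coe (g : G) {x : G ⧸ H} (hg : (g : G ⧸ H) = x) (m : M.carrier) :
    (fibreLin M g hg m).1 = mk M g m := rfl

variable (M) in
/-- The action of `a ∈ G`, as a linear map between the fibres over `x` and `y = a • x`. -/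
noncomputable def act (a : G) {x y : G ⧸ H} (h : a • x = y) : Fibre M x →ₗ[ℂ] Fibre M y where
  toFun z := ⟨smul a z.1, by rw [proj_smul, z.2, h]⟩
  map_add' z w := by
    have hx := QuotientGroup.out_eq' x
    have hy : ((a * x.out : G) : G ⧸ H) = y := by
      rw [← h]; conv_rhs => rw [← hx]
      rfl
    have key : ∀ (m : M.carrier) (p), (⟨smul a (fibreLin M x.out hx m).1, p⟩ : Fibre M y) =
      fibreLin M (a * x.out) hy m := fun _ _ => rfl
    obtain ⟨m, rfl⟩ := (fibreLin M x.out hx).surjective z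
    obtain ⟨m', rfl⟩ := (fibreLin M x.out hx).surjective w
    simp only [← map_add, key]
  map_smul' c z := by
    have hx := QuotientGroup.out_eq' x
    have hy : ((a * x.out : G) : G ⧸ H) = y := by
      rw [← h]; conv_rhs => rw [← hx]
      rfl
    have key : ∀ (m : M.carrier) (p), (⟨smul a (fibreLin M x.out hx m).1, p⟩ : Fibre M y) =
      fibreLin M (a * x.out) hy m := fun _ _ => rfl
    obtain ⟨m, rfl⟩ := (fibreLin M x.out hx).surjective z
    simp only [← map_smul, key, RingHom.id_apply]

theorem act_fibreLin (a g : G) (m : M.carrier) :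
    act M a (x := (g : G ⧸ H)) (y := a • (g : G ⧸ H)) rfl (fibreLin M g rfl m) =
      fibreLin M (a * g) rfl m := rfl

theorem map_fibreLin (g : G) {W : Type*} [AddCommGroup W] [Module ℂ W]
    (L : Fibre M (g : G ⧸ H) →ₗ[ℂ] W) (v : Fibre M (g : G ⧸ H)) :
    L v = ∑ b, (Module.finBasis ℂ M.carrier).coord b ((fibreLin M g rfl).symm v) •
      L (fibreLin M g rfl (Module.finBasis ℂ M.carrier b)) := by
  obtain ⟨m, rfl⟩ := (fibreLin M g rfl).surjective v
  conv_lhs => rw [← (Module.finBasis ℂ M.carrier).sum_repr m]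
  rw [map_sum, map_sum]
  exact Finset.sum_congr rfl fun b _ => by simp

variable (V k) in
/-- `G ×_H M` as an equivariant family of vector spaces over `G/H`. Its `C^k` structure is that of
the quotient of `G × M`: a local frame is admitted if the corresponding trivialization of the
pull-back `G × M` of `G ×_H M` to `G` and its inverse are of class `C^k`. -/
noncomputable def family [LieGroup 𝓘(ℝ, V) ∞ G] (M : FinRep H) : EquivariantFamily V k H where
  fib := Fibre M
  act := act M
  act_one h v := by
    refine Subtype.ext ?_
    obtain ⟨z, hz⟩ := v
    induction z using Quotient.ind
    rename_i p
    change mk M (1 * p.1) p.2 = mk M p.1 p.2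
    rw [one_mul]
  act_mul a b _ _ _ _ _ _ v := by
    refine Subtype.ext ?_
    obtain ⟨z, hz⟩ := v
    induction z using Quotient.ind
    rename_i p
    change mk M (a * b * p.1) p.2 = mk M (a * (b * p.1)) p.2
    rw [mul_assoc]
  frames := {e |
    (∀ (i : e.ι) (l : Dual ℂ M.carrier),
      CkOn V k e.pre (fun g => l ((fibreLin M g rfl).symm (e.vec g i)))) ∧
    (∀ (m : M.carrier) (j : e.ι), CkOn V k e.pre (fun g => e.coord g (fibreLin M g rfl m) j))}
  contMDiff_transition e he f hf i j := by
    refine (CkOn.sum (fun b => ((he.1 i ((Module.finBasis ℂ M.carrier).coord b)).mono ?_).mul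
      ((hf.2 (Module.finBasis ℂ M.carrier b) j).mono ?_))).congr ?_
    · exact fun x hx => hx.1
    · exact fun x hx => hx.2
    · intro g hg
      exact map_fibreLin g ((LinearMap.proj j).comp (f.coord g)) (e.vec g i)
  contMDiff_act e he f hf i j := by
    refine (CkOn₂.sum (fun b =>
      ((he.1 i ((Module.finBasis ℂ M.carrier).coord b)).comp_snd ?_).mul
      ((hf.2 (Module.finBasis ℂ M.carrier b) j).comp_mul ?_))).congr ?_
    · exact fun x hx => hx.1
    · exact fun x hx => hx.2
    · intro p hp
      exact map_fibreLin p.2 ((LinearMap.proj j).comp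
        ((f.coord (p.1 • (p.2 : G ⧸ H))).comp (act M p.1 rfl))) (e.vec p.2 i)

end Assoc
end Associated

end EquivariantK

open EquivariantK

/-! The crux is the local triviality of $G\times_H M$. It is obtained without a local section of
$G\to G/H$ and without a manifold structure on $H$, by averaging over the Haar measure of $H$. Let
$\rho$ be the matrix of the action on $M$, let $\varphi\ge 0$ be a bump function at the identity of
$G$, and put $A(g)=\int_H\varphi(gh)\rho(h)\,dh$. Left invariance of the measure gives
$A(g)=\rho(h)A(gh)$. So $[g,A(g)b_i]$ depends only on the coset $gH$, and the columns of $A$ are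
sections of $G\times_H M$.

These sections are smooth because $g$ enters the integral only through $\varphi$; continuity of
$\rho$ is enough (`contDiffOn_setIntegral`, `exists_bump_average`). If $\varphi$ is supported where
$\rho$ is close to $1$, then $A(1)$ is close to a positive multiple of the identity matrix, hence
invertible (`exists_equivariant_matrix`). The sections therefore form a frame near the identity
coset (`Assoc.exists_frame`), and left translation gives frames near every other coset
(`Assoc.family_isLocallyTrivial`).

For a bundle $E$, the map $[g,m]\mapsto gm$ is well defined and bijective on fibres for purely
algebraic reasons. In local frames it and its inverse $v\mapsto[g,g^{-1}v]$ are $C^k$, since the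
action is $C^k$ along $g\mapsto(g,1)$ and along $g\mapsto(g^{-1},g)$ (`Assoc.fibreRepIso`).

Finally, the fibre over the identity coset takes sums and tensor products of bundles to those of
modules, and $m\mapsto[1,m]$ identifies $M$ with the fibre of $G\times_H M$. So isomorphism classes
of bundles and of modules form isomorphic semirings (`Vect.fibreEquiv`), and the Grothendieck rings
are isomorphic as well. -/

namespace EquivariantK

/-! ### Differentiation under the integral sign over a compact set -/

section ParametricIntegral
open MeasureTheory Topology

/-- An integral over a compact set depends smoothly on a parameter if the integrand does. -/
theorem contDiffOn_setIntegral {V W X : Type*} [NormedAddCommGroup V] [NormedSpace ℝ V]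
    [FiniteDimensional ℝ V] [NormedAddCommGroup W] [NormedSpace ℝ W]
    [TopologicalSpace X] [MeasurableSpace X] [OpensMeasurableSpace X] {μ : Measure X}
    [IsFiniteMeasureOnCompacts μ] {U : Set V} {T : Set W} (hU : IsOpen U) (hT : IsOpen T)
    {K : Set X} (hK : IsCompact K) (hKm : MeasurableSet K) {γ : X → W} (hγ : ContinuousOn γ K)
    (hγT : ∀ h ∈ K, γ h ∈ T) {f : X → ℂ} (hf : ContinuousOn f K) (n : ℕ) :
    ∀ {Ψ : V × W → ℂ}, ContDiffOn ℝ ∞ Ψ (U ×ˢ T) →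
      ContDiffOn ℝ n (fun x => ∫ h in K, Ψ (x, γ h) * f h ∂μ) U := by
  have : IsFiniteMeasure (μ.restrict K) := ⟨by simpa using hK.measure_lt_top⟩
  have hUT : IsOpen (U ×ˢ T) := hU.prod hT
  have hderiv : ∀ {Ψ : V × W → ℂ}, ContDiffOn ℝ ∞ Ψ (U ×ˢ T) → ∀ x₀ ∈ U,
      HasFDerivAt (fun x => ∫ h in K, Ψ (x, γ h) * f h ∂μ)
        (∫ h in K, f h • (fderiv ℝ Ψ (x₀, γ h)).comp (ContinuousLinearMap.inl ℝ V W) ∂μ) x₀ := by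
    intro Ψ hΨ x₀ hx₀
    obtain ⟨r, hr, hrU⟩ := Metric.nhds_basis_closedBall.mem_iff.1 (hU.mem_nhds hx₀)
    have hDcont : ContinuousOn (fderiv ℝ Ψ) (U ×ˢ T) :=
      hΨ.continuousOn_fderiv_of_isOpen hUT (by simp)
    have hpair : ∀ x ∈ U, ContinuousOn (fun h => (x, γ h)) K := fun x _ =>
      continuousOn_const.prodMk hγ
    have hmaps : ∀ x ∈ U, Set.MapsTo (fun h => (x, γ h)) K (U ×ˢ T) := fun x hx h hh =>
      ⟨hx, hγT h hh⟩
    have hF : ∀ x ∈ U, ContinuousOn (fun h => Ψ (x, γ h) * f h) K := fun x hx =>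
      (hΨ.continuousOn.comp (hpair x hx) (hmaps x hx)).mul hf
    have hF' : ContinuousOn (fun p : V × X =>
        f p.2 • (fderiv ℝ Ψ (p.1, γ p.2)).comp (ContinuousLinearMap.inl ℝ V W))
        (Metric.closedBall x₀ r ×ˢ K) := by
      refine (hf.comp continuousOn_snd fun p hp => hp.2).smul ?_
      refine ContinuousOn.clm_comp ?_ continuousOn_const
      refine hDcont.comp (continuousOn_fst.prodMk (hγ.comp continuousOn_snd fun p hp => hp.2)) ?_
      exact fun p hp => ⟨hrU hp.1, hγT _ hp.2⟩
    -- Closed balls of the finite-dimensional `V` are compact, so the partial derivative is bounded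
    -- on ball times `K`. The constant bound is integrable because `K` has finite measure.
    obtain ⟨C, hC⟩ := ((isCompact_closedBall x₀ r).prod hK).exists_bound_of_continuousOn hF'
    refine hasFDerivAt_integral_of_dominated_of_fderiv_le (s := Metric.closedBall x₀ r)
      (bound := fun _ => C)
      (F' := fun x h => f h • (fderiv ℝ Ψ (x, γ h)).comp (ContinuousLinearMap.inl ℝ V W))
      (Metric.closedBall_mem_nhds _ hr) ?_ ?_ ?_ ?_ ?_ ?_
    · filter_upwards [hU.mem_nhds hx₀] with x hx
      exact (hF x hx).aestronglyMeasurable_of_isCompact hK hKm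
    · exact (hF x₀ hx₀).integrableOn_compact' hK hKm
    · refine ContinuousOn.aestronglyMeasurable_of_isCompact ?_ hK hKm
      exact hF'.comp (continuousOn_const.prodMk continuousOn_id)
        fun h hh => ⟨Metric.mem_closedBall_self hr.le, hh⟩
    · filter_upwards [ae_restrict_mem hKm] with h hh x hx using hC (x, h) ⟨hx, hh⟩
    · exact integrable_const _
    · filter_upwards [ae_restrict_mem hKm] with h hh x hx
      have h1 : HasFDerivAt Ψ (fderiv ℝ Ψ (x, γ h)) (x, γ h) :=
        ((hΨ.contDiffAt (hUT.mem_nhds ⟨hrU hx, hγT h hh⟩)).differentiableAt (by simp)).hasFDerivAt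
      have h2 : HasFDerivAt (fun x : V => (x, γ h)) (ContinuousLinearMap.inl ℝ V W) x :=
        hasFDerivAt_prodMk_left x (γ h)
      exact (h1.comp x h2).mul_const (f h)
  -- `Ψ` is quantified inside the induction: a directional derivative of the integral is an integral
  -- of the same kind, with a partial derivative of `Ψ` in place of `Ψ`.
  induction n with
  | zero =>
    intro Ψ hΨ
    exact contDiffOn_zero.2 fun x hx => (hderiv hΨ x hx).continuousAt.continuousWithinAt
  | succ n ih =>
    intro Ψ hΨ
    refine (contDiffOn_succ_iff_fderiv_apply (n := (n : WithTop ℕ∞)) hU.uniqueDiffOn).2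
      ⟨fun x hx => (hderiv hΨ x hx).differentiableAt.differentiableWithinAt,
        -- The analyticity clause concerns the exponent `ω` only and is vacuous for a natural
        -- number.
        fun h => absurd h (by simp), fun y => ?_⟩
    have hΨ' : ContDiffOn ℝ ∞ (fun p => fderiv ℝ Ψ p (y, 0)) (U ×ˢ T) :=
      (hΨ.fderiv_of_isOpen hUT (by simp)).clm_apply contDiffOn_const
    refine (ih hΨ').congr fun x hx => ?_
    rw [fderivWithin_of_isOpen hU hx, (hderiv hΨ x hx).fderiv,
      ContinuousLinearMap.integral_apply]
    · refine integral_congr_ae (Filter.Eventually.of_forall fun h => ?_)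
      simp [mul_comm]
    · have hD : ContinuousOn (fun h => f h •
          (fderiv ℝ Ψ (x, γ h)).comp (ContinuousLinearMap.inl ℝ V W)) K := by
        refine hf.smul (ContinuousOn.clm_comp ?_ continuousOn_const)
        exact (hΨ.continuousOn_fderiv_of_isOpen hUT (by simp)).comp
          (continuousOn_const.prodMk hγ) fun h hh => ⟨hx, hγT h hh⟩
      exact hD.integrableOn_compact' hK hKm

end ParametricIntegral

end EquivariantK

namespace EquivariantK

/-! ### Bump functions and smooth averages over a closed subgroup -/

section Averaging
open MeasureTheory Topology

variable {V : Type v} [NormedAddCommGroup V] [NormedSpace ℝ V] [FiniteDimensional ℝ V]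
  {G : Type u} [TopologicalSpace G] [T2Space G] [Group G] [ChartedSpace V G]
  [LieGroup 𝓘(ℝ, V) ∞ G] {H : Subgroup G}

variable (V) in
/-- There are bump functions at the identity whose convolutions with continuous functions on a
closed subgroup are smooth near the identity. -/
theorem exists_bump_average (hH : IsClosed (H : Set G)) [MeasurableSpace H] [BorelSpace H]
    (μ : Measure H) [IsFiniteMeasureOnCompacts μ] {S : Set G} (hS : S ∈ 𝓝 (1 : G)) :
    ∃ φ : G → ℝ, Continuous φ ∧ HasCompactSupport φ ∧ (∀ g, 0 ≤ φ g) ∧ φ 1 = 1 ∧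
      (∀ g, φ g ≠ 0 → g ∈ S) ∧ ∃ W : Set G, IsOpen W ∧ 1 ∈ W ∧ ∀ f : H → ℂ, Continuous f →
        ContMDiffOn 𝓘(ℝ, V) 𝓘(ℝ, ℂ) ∞ (fun g => ∫ h : H, (φ (g * h) : ℂ) * f h ∂μ) W := by
  have : IsTopologicalGroup G := topologicalGroup_of_lieGroup 𝓘(ℝ, V) ∞
  have : LocallyCompactSpace G := ChartedSpace.locallyCompactSpace V G
  set c := chartAt V (1 : G) with hc
  have h1c : (1 : G) ∈ c.source := mem_chart_source V 1
  obtain ⟨N, hN1, hNc, hN⟩ := local_compact_nhds (c.open_source.mem_nhds h1c)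
  -- Since $h=g^{-1}(gh)$, for $g$ near $1$ and $\varphi$ supported near $1$ every $h$ with
  -- $\varphi(gh)\ne0$ lies in the fixed compact set `N`, whatever $g$ is.
  have hdiv : Filter.Tendsto (fun p : G × G => p.1⁻¹ * p.2) (𝓝 1 ×ˢ 𝓝 1) (𝓝 1) := by
    have : Continuous fun p : G × G => p.1⁻¹ * p.2 := by fun_prop
    simpa [nhds_prod_eq] using this.tendsto ((1 : G), (1 : G))
  obtain ⟨W', hW', S', hS', hWS⟩ := Filter.mem_prod_iff.1 (hdiv hN1)
  obtain ⟨W, hWsub, hWo, hW1⟩ := mem_nhds_iff.1 (Filter.inter_mem hW' (c.open_source.mem_nhds h1c))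
  obtain ⟨φ, -, hφ⟩ := (SmoothBumpFunction.nhds_basis_tsupport (I := 𝓘(ℝ, V)) (1 : G)).mem_iff.1
    (Filter.inter_mem hS hS')
  have hφ' : ∀ g, φ g ≠ 0 → g ∈ S ∩ S' := fun g hg => hφ (subset_tsupport _ hg)
  refine ⟨φ, φ.continuous, φ.hasCompactSupport, fun _ => φ.nonneg, φ.eq_one,
    fun g hg => (hφ' g hg).1, W, hWo, hW1, fun f hf => ?_⟩
  set K : Set H := {h | (h : G) ∈ N}
  -- Closedness of `H` is what makes its trace on the compact set `N` compact.
  have hK : IsCompact K := hH.isClosedEmbedding_subtypeVal.isCompact_preimage hN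
  have hKm : MeasurableSet K := hK.isClosed.measurableSet
  set U : Set V := c.target ∩ c.symm ⁻¹' W
  have hU : IsOpen U := c.isOpen_inter_preimage_symm hWo
  -- Both $g$ and $h$ are read in the same chart at the identity of `G`, so that no chart of `H` is
  -- needed.
  set Ψ : V × V → ℂ := fun p => (φ (c.symm p.1 * c.symm p.2) : ℂ)
  have hΨ : ContDiffOn ℝ ∞ Ψ (U ×ˢ c.target) := by
    rw [← contMDiffOn_iff_contDiffOn]
    have hs : ContMDiffOn 𝓘(ℝ, V) 𝓘(ℝ, V) ∞ c.symm c.target := contMDiffOn_chart_symm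
    have h1 : ContMDiffOn 𝓘(ℝ, V × V) 𝓘(ℝ, V) ∞ (fun p : V × V => c.symm p.1) (U ×ˢ c.target) :=
      hs.comp contDiff_fst.contMDiff.contMDiffOn fun p hp => hp.1.1
    have h2 : ContMDiffOn 𝓘(ℝ, V × V) 𝓘(ℝ, V) ∞ (fun p : V × V => c.symm p.2) (U ×ˢ c.target) :=
      hs.comp contDiff_snd.contMDiff.contMDiffOn fun p hp => hp.2
    have h3 := φ.contMDiff.comp_contMDiffOn (h1.mul h2)
    exact (Complex.ofRealCLM.contDiff.contMDiff).comp_contMDiffOn h3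
  have hJ : ContDiffOn ℝ ∞ (fun x => ∫ h in K, Ψ (x, c (h : G)) * f h ∂μ) U :=
    contDiffOn_infty.2 fun n => contDiffOn_setIntegral hU c.open_target hK hKm
      (c.continuousOn.comp continuous_subtype_val.continuousOn fun h hh => hNc hh)
      (fun h hh => c.map_source (hNc hh)) hf.continuousOn n hΨ
  have hWc : ∀ g ∈ W, g ∈ c.source := fun g hg => (hWsub hg).2
  refine (hJ.contMDiffOn.comp (contMDiffOn_chart.mono hWc)
    (fun g hg => ⟨c.map_source (hWc g hg), by
      change c.symm (c g) ∈ W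
      rwa [c.left_inv (hWc g hg)]⟩)).congr ?_
  intro g hg
  -- For $g$ in `W` the integrand vanishes off `K`, by the choice of `W'` and `S'`.
  rw [← setIntegral_eq_integral_of_forall_compl_eq_zero (s := K)]
  · refine setIntegral_congr_fun hKm fun h hh => ?_
    simp only [Ψ]
    rw [c.left_inv (hWc g hg), c.left_inv (hNc hh)]
  · intro h hh
    by_contra hne
    refine hh ?_
    have hgh : g * h ∈ S' := (hφ' _ fun h0 => hne (by simp [h0])).2
    simpa [K] using hWS (Set.mk_mem_prod (hWsub hg).1 hgh)

end Averaging

end EquivariantK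

namespace EquivariantK

/-! ### Averaging a representation to an equivariant matrix function -/

section AveragedMatrix
open MeasureTheory Topology

variable {V : Type v} [NormedAddCommGroup V] [NormedSpace ℝ V] [FiniteDimensional ℝ V]
  {G : Type u} [TopologicalSpace G] [T2Space G] [Group G] [ChartedSpace V G]
  [LieGroup 𝓘(ℝ, V) ∞ G] {H : Subgroup G}

/-- The matrices of a representation in the standard basis. -/
noncomputable def FinRep.matrix {H : Type u} [Group H] [TopologicalSpace H] (M : FinRep H) (h : H) :
    Matrix (Fin (Module.finrank ℂ M.carrier)) (Fin (Module.finrank ℂ M.carrier)) ℂ :=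
  LinearMap.toMatrix (Module.finBasis ℂ M.carrier) (Module.finBasis ℂ M.carrier) (M.ρ h)

theorem FinRep.matrix_mul {H : Type u} [Group H] [TopologicalSpace H] (M : FinRep H) (h h' : H) :
    M.matrix (h * h') = M.matrix h * M.matrix h' := by
  rw [FinRep.matrix, map_mul, LinearMap.toMatrix_mul]; rfl

theorem FinRep.matrix_one {H : Type u} [Group H] [TopologicalSpace H] (M : FinRep H) :
    M.matrix 1 = 1 := by
  rw [FinRep.matrix, map_one, LinearMap.toMatrix_one]

theorem FinRep.continuous_matrix {H : Type u} [Group H] [TopologicalSpace H] (M : FinRep H)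
    (i j : Fin (Module.finrank ℂ M.carrier)) : Continuous fun h => M.matrix h i j := by
  refine (M.continuous_coeff (Module.finBasis ℂ M.carrier j)
    ((Module.finBasis ℂ M.carrier).coord i)).congr fun h => ?_
  simp [FinRep.matrix, LinearMap.toMatrix_apply]

variable (V) in
/-- A matrix-valued function on `G` that is equivariant under a closed subgroup, smooth near the
identity and invertible there, obtained by averaging a representation of the subgroup. -/
theorem exists_equivariant_matrix (hH : IsClosed (H : Set G)) (M : FinRep H) :
    ∃ A : G → Matrix (Fin (Module.finrank ℂ M.carrier)) (Fin (Module.finrank ℂ M.carrier)) ℂ,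
      (∀ (g : G) (h : H), A g = M.matrix h * A (g * h)) ∧ (A 1).det ≠ 0 ∧
      ∃ W : Set G, IsOpen W ∧ 1 ∈ W ∧
        ∀ i j, ContMDiffOn 𝓘(ℝ, V) 𝓘(ℝ, ℂ) ∞ (fun g => A g i j) W := by
  have : IsTopologicalGroup G := topologicalGroup_of_lieGroup 𝓘(ℝ, V) ∞
  have : LocallyCompactSpace G := ChartedSpace.locallyCompactSpace V G
  have hemb := hH.isClosedEmbedding_subtypeVal
  have : LocallyCompactSpace H := hemb.locallyCompactSpace
  let _ : MeasurableSpace H := borel H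
  have : BorelSpace H := ⟨rfl⟩
  set μ : Measure H := Measure.haar
  set n := Module.finrank ℂ M.carrier
  -- Any positive $\varepsilon$ with $n\varepsilon<1$ would do: with entries within $\varepsilon c$
  -- of $c\cdot 1$, diagonal dominance requires $(n-1)\varepsilon c<c-\varepsilon c$.
  set ε : ℝ := 1 / (n + 1) with hε
  have hε0 : 0 < ε := by positivity
  have hnear : ∀ᶠ h : H in 𝓝 1, ∀ i j, ‖M.matrix h i j - (1 : Matrix (Fin n) (Fin n) ℂ) i j‖ < ε := by
    refine Filter.eventually_all.2 fun i => Filter.eventually_all.2 fun j => ?_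
    have := ((M.continuous_matrix i j).sub
      (continuous_const (y := (1 : Matrix (Fin n) (Fin n) ℂ) i j))).norm.tendsto (1 : H)
    refine this.eventually (gt_mem_nhds ?_)
    simpa [M.matrix_one] using hε0
  obtain ⟨S, hS, hSH⟩ := (mem_nhds_induced _ _ _).1 hnear
  obtain ⟨φ, hφc, hφs, hφ0, hφ1, hφS, W, hW, hW1, hsm⟩ := exists_bump_average V hH μ hS
  have hcs : ∀ g : G, HasCompactSupport fun h : H => φ (g * h) := fun g =>
    hφs.comp_isClosedEmbedding ((Homeomorph.mulLeft g).isClosedEmbedding.comp hemb)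
  have hcont : ∀ g : G, Continuous fun h : H => φ (g * h) := fun g => by fun_prop
  have hint : ∀ (g : G) (f : H → ℂ), Continuous f →
      Integrable (fun h : H => (φ (g * h) : ℂ) * f h) μ := fun g f hf =>
    ((Complex.continuous_ofReal.comp (hcont g)).mul hf).integrable_of_hasCompactSupport
      (((hcs g).comp_left (g := fun r : ℝ => (r : ℂ)) (by simp)).mul_right)
  refine ⟨fun g => Matrix.of fun i j => ∫ h : H, (φ (g * h) : ℂ) * M.matrix h i j ∂μ, ?_, ?_, W, hW,
    hW1, fun i j => hsm _ (M.continuous_matrix i j)⟩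
  · intro g h₀
    ext i j
    simp only [Matrix.of_apply, Matrix.mul_apply]
    -- The substitution $h\mapsto h_0h$ turns $\varphi(gh)\rho(h)$ into
    -- $\varphi(gh_0h)\rho(h_0)\rho(h)$, and $\rho(h_0)$ comes out of the integral.
    rw [← integral_mul_left_eq_self _ h₀]
    simp only [M.matrix_mul, Matrix.mul_apply, Subgroup.coe_mul, Finset.mul_sum, mul_assoc]
    rw [integral_finsetSum]
    · refine Finset.sum_congr rfl fun l _ => ?_
      rw [← integral_const_mul]
      refine integral_congr_ae (Filter.Eventually.of_forall fun h => ?_)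
      simp only
      ring
    · intro l _
      have := (hint (g * h₀) _ (M.continuous_matrix l j)).const_mul (M.matrix h₀ i l)
      refine this.congr (Filter.Eventually.of_forall fun h => ?_)
      simp only [mul_assoc]
      ring
  · set A : Matrix (Fin n) (Fin n) ℂ :=
      Matrix.of fun i j => ∫ h : H, (φ (1 * h) : ℂ) * M.matrix h i j ∂μ with hA
    set c : ℝ := ∫ h : H, φ (1 * h) ∂μ with hc
    have hφi : Integrable (fun h : H => φ (1 * h)) μ :=
      (hcont 1).integrable_of_hasCompactSupport (hcs 1)
    -- The mass of the bump along `H` is positive because $\varphi(1)=1$ and Haar measure charges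
    -- nonempty open sets.
    have hc0 : 0 < c := (hcont 1).integral_pos_of_hasCompactSupport_nonneg_nonzero (hcs 1)
      (fun h => hφ0 _) (x := 1) (by simp [hφ1])
    have hAc : ∀ i j, ‖A i j - c * (1 : Matrix (Fin n) (Fin n) ℂ) i j‖ ≤ ε * c := by
      intro i j
      have h1 : A i j - c * (1 : Matrix (Fin n) (Fin n) ℂ) i j =
          ∫ h : H, (φ (1 * h) : ℂ) * (M.matrix h i j - (1 : Matrix (Fin n) (Fin n) ℂ) i j) ∂μ := by
        simp only [mul_sub]
        rw [integral_sub (hint 1 _ (M.continuous_matrix i j)) (hint 1 _ continuous_const),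
          integral_mul_const, hA, hc, integral_complex_ofReal]
        rfl
      rw [h1, hc, ← integral_const_mul]
      refine norm_integral_le_of_norm_le (hφi.const_mul ε) (Filter.Eventually.of_forall fun h => ?_)
      rw [norm_mul, Complex.norm_real, Real.norm_of_nonneg (hφ0 _), mul_comm]
      -- Outside the support there is nothing to bound; on it, `h` lies in `S`, where the matrix is
      -- within `ε` of the identity entry by entry.
      by_cases h0 : φ (1 * h) = 0
      · simp only [h0, mul_zero, le_refl]
      · have : (h : G) ∈ S := by simpa using hφS _ h0
        exact mul_le_mul_of_nonneg_right (hSH this i j).le (hφ0 _)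
    -- Invertibility is strict diagonal dominance: the off-diagonal row sum is at most
    -- $(n-1)\varepsilon c$ and the diagonal entry has norm at least $c-\varepsilon c$.
    refine det_ne_zero_of_sum_row_lt_diag fun i => ?_
    have h1 : ∑ j ∈ Finset.univ.erase i, ‖A i j‖ ≤ ∑ j ∈ Finset.univ.erase i, ε * c :=
      Finset.sum_le_sum fun j hj => by
        simpa [Matrix.one_apply_ne (Finset.ne_of_mem_erase hj).symm] using hAc i j
    have h2 : ∑ j ∈ Finset.univ.erase i, ε * c + ε * c = n * (ε * c) := by
      rw [Finset.sum_erase_add _ _ (Finset.mem_univ i)]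
      simp [n]
    have h3 : c - ‖A i i‖ ≤ ε * c := by
      have h4 := hAc i i
      rw [Matrix.one_apply_eq, mul_one, norm_sub_rev] at h4
      have h5 := norm_sub_norm_le (c : ℂ) (A i i)
      rw [Complex.norm_real, Real.norm_of_nonneg hc0.le] at h5
      exact h5.trans h4
    have h6 : (n : ℝ) * (ε * c) + ε * c = c := by rw [hε]; field_simp
    have h7 : 0 < ε * c := by positivity
    linarith

end AveragedMatrix

end EquivariantK

namespace EquivariantK

/-! ### Determinants, inverse matrices and translates of $C^k$ functions -/

section MatrixFunctions

variable {V : Type v} [NormedAddCommGroup V] [NormedSpace ℝ V]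
  {P : Type u} [TopologicalSpace P] [ChartedSpace V P] {k : ℕ∞} {s : Set P}

theorem CkOn.prod {ι : Type*} [Fintype ι] {f : ι → P → ℂ} (hf : ∀ i, CkOn V k s (f i)) :
    CkOn V k s (fun x => ∏ i, f i x) := by
  classical
  have : ∀ t : Finset ι, CkOn V k s (fun x => ∏ i ∈ t, f i x) := by
    intro t
    induction t using Finset.induction_on with
    | empty => simpa using CkOn.const 1
    | insert a t ha ih => simpa only [Finset.prod_insert ha] using (hf a).mul ih
  exact this Finset.univ

theorem CkOn.inv {f : P → ℂ} (hf : CkOn V k s f) (h0 : ∀ x ∈ s, f x ≠ 0) :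
    CkOn V k s (fun x => (f x)⁻¹) := fun x hx =>
  ((contDiffAt_inv ℝ (h0 x hx)).contMDiffAt).comp_contMDiffWithinAt x (hf x hx)

theorem CkOn.det {n : Type*} [Fintype n] [DecidableEq n] {A : P → Matrix n n ℂ}
    (hA : ∀ i j, CkOn V k s (fun x => A x i j)) : CkOn V k s (fun x => (A x).det) := by
  simp only [Matrix.det_apply']
  exact CkOn.sum fun σ => (CkOn.const _).mul (CkOn.prod fun i => hA _ _)

/-- Cramer's rule: the entries of the inverse are determinants divided by the determinant, and each
row of the matrices involved is either constant or a row of `A`. -/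
theorem CkOn.matrix_inv {n : Type*} [Fintype n] [DecidableEq n] {A : P → Matrix n n ℂ}
    (hA : ∀ i j, CkOn V k s (fun x => A x i j)) (h0 : ∀ x ∈ s, (A x).det ≠ 0) (i j : n) :
    CkOn V k s (fun x => (A x)⁻¹ i j) := by
  simp only [Matrix.inv_def, Matrix.smul_apply, Matrix.adjugate_apply, Ring.inverse_eq_inv',
    smul_eq_mul]
  refine ((CkOn.det hA).inv h0).mul (CkOn.det fun a b => ?_)
  by_cases h : a = j
  · subst h
    simpa using CkOn.const _
  · simpa [Matrix.updateRow_ne h] using hA a b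

variable [Group P] [LieGroup 𝓘(ℝ, V) ∞ P]

theorem CkOn.comp_mul_right {f : P → ℂ} (hf : CkOn V k s f) (a : P) :
    CkOn V k {g | g * a ∈ s} (fun g => f (g * a)) :=
  ContMDiffOn.comp hf ((contMDiff_mul_right (I := 𝓘(ℝ, V)) (n := ∞)).of_le
    (by exact_mod_cast le_top)).contMDiffOn fun _ h => h

theorem CkOn.comp_mul_left {f : P → ℂ} (hf : CkOn V k s f) (a : P) :
    CkOn V k {g | a * g ∈ s} (fun g => f (a * g)) :=
  ContMDiffOn.comp hf ((contMDiff_mul_left (I := 𝓘(ℝ, V)) (n := ∞)).of_le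
    (by exact_mod_cast le_top)).contMDiffOn fun _ h => h

end MatrixFunctions

/-! ### Frames of $G\times_H M$ from equivariant matrix functions -/

namespace Assoc
variable {V : Type v} [NormedAddCommGroup V] [NormedSpace ℝ V]
  {G : Type u} [TopologicalSpace G] [Group G] [ChartedSpace V G] {k : ℕ∞} {H : Subgroup G}

/-- This compares two representatives of one coset. Constructions made with the arbitrary
representative `x.out` are shown independent of it by this rule. -/
theorem fibreLin_mul (M : FinRep H) (g : G) (h : H) {x : G ⧸ H} (hg : (g : G ⧸ H) = x)
    (hgh : ((g * h : G) : G ⧸ H) = x) (m : M.carrier) :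
    fibreLin M (g * h) hgh m = fibreLin M g hg (M.ρ h m) := Subtype.ext (mk_mul g h m)

/-- The vector with index `i` over `x` of the frame given by a matrix-valued function. -/
noncomputable def frameVec (M : FinRep H)
    (A : G → Matrix (Fin (Module.finrank ℂ M.carrier)) (Fin (Module.finrank ℂ M.carrier)) ℂ)
    (x : G ⧸ H) (i : Fin (Module.finrank ℂ M.carrier)) : Fibre M x :=
  fibreLin M x.out (QuotientGroup.out_eq' x)
    (Matrix.toLin (Module.finBasis ℂ M.carrier) (Module.finBasis ℂ M.carrier) (A x.out)
      (Module.finBasis ℂ M.carrier i))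

/-- The coordinates over `x` of the frame given by a matrix-valued function. -/
noncomputable def frameCoord (M : FinRep H)
    (A : G → Matrix (Fin (Module.finrank ℂ M.carrier)) (Fin (Module.finrank ℂ M.carrier)) ℂ)
    (x : G ⧸ H) : Fibre M x →ₗ[ℂ] (Fin (Module.finrank ℂ M.carrier) → ℂ) :=
  (Module.finBasis ℂ M.carrier).equivFun.toLinearMap ∘ₗ
    Matrix.toLin (Module.finBasis ℂ M.carrier) (Module.finBasis ℂ M.carrier) (A x.out)⁻¹ ∘ₗ
      (fibreLin M x.out (QuotientGroup.out_eq' x)).symm.toLinearMap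

section
variable {M : FinRep H}
  {A : G → Matrix (Fin (Module.finrank ℂ M.carrier)) (Fin (Module.finrank ℂ M.carrier)) ℂ}
  (hA : ∀ (g : G) (h : H), A g = M.matrix h * A (g * h))
include hA

/-- Equivariance makes the chosen representative irrelevant:
$[gh,A(gh)b_i]=[g,\rho(h)A(gh)b_i]=[g,A(g)b_i]$. -/
theorem frameVec_coe (g : G) (i) : frameVec M A (g : G ⧸ H) i = fibreLin M g rfl
    (Matrix.toLin (Module.finBasis ℂ M.carrier) (Module.finBasis ℂ M.carrier) (A g)
      (Module.finBasis ℂ M.carrier i)) := by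
  obtain ⟨h, hh⟩ := QuotientGroup.mk_out_eq_mul H g
  -- The representative occurs in a proof argument, so it is generalized to a variable before
  -- $g'=gh$ is substituted. The same device recurs below.
  have key : ∀ (g' : G) (hg' : (g' : G ⧸ H) = (g : G ⧸ H)), g' = g * h →
      fibreLin M g' hg' (Matrix.toLin (Module.finBasis ℂ M.carrier) (Module.finBasis ℂ M.carrier)
        (A g') (Module.finBasis ℂ M.carrier i)) = fibreLin M g rfl
      (Matrix.toLin (Module.finBasis ℂ M.carrier) (Module.finBasis ℂ M.carrier) (A g)
        (Module.finBasis ℂ M.carrier i)) := by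
    rintro _ hg' rfl
    rw [fibreLin_mul M g h rfl, hA g h, Matrix.toLin_mul _ (Module.finBasis ℂ M.carrier),
      FinRep.matrix, Matrix.toLin_toMatrix]
    rfl
  exact key _ _ hh

/-- Dual to the frame vectors: the vector $[g,m]$ equals $[gh,\rho(h)^{-1}m]$, and
$A(gh)^{-1}\rho(h)^{-1}=A(g)^{-1}$. Since `Matrix.mul_inv_rev` is unconditional and only
$\rho(h^{-1})$ is cancelled, $A(g)$ may be singular. -/
theorem frameCoord_coe (g : G) (m : M.carrier) (j) :
    frameCoord M A (g : G ⧸ H) (fibreLin M g rfl m) j =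
      ∑ l, (A g)⁻¹ j l * (Module.finBasis ℂ M.carrier).repr m l := by
  obtain ⟨h, hh⟩ := QuotientGroup.mk_out_eq_mul H g
  have key : ∀ (g' : G) (hg' : (g' : G ⧸ H) = (g : G ⧸ H)), g' = g * h →
      (Module.finBasis ℂ M.carrier).equivFun
        (Matrix.toLin (Module.finBasis ℂ M.carrier) (Module.finBasis ℂ M.carrier) (A g')⁻¹
          ((fibreLin M g' hg').symm (fibreLin M g rfl m))) j =
      ∑ l, (A g)⁻¹ j l * (Module.finBasis ℂ M.carrier).repr m l := by
    rintro _ hg' rfl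
    have h1 : (fibreLin M (g * h) hg').symm (fibreLin M g rfl m) = M.ρ h⁻¹ m := by
      rw [LinearEquiv.symm_apply_eq, fibreLin_mul M g h rfl]
      simp
    have h2 : A (g * h) = M.matrix h⁻¹ * A g := by
      have := hA (g * h) h⁻¹
      simpa using this
    have h3 : (M.matrix h⁻¹)⁻¹ * M.matrix h⁻¹ = 1 :=
      Matrix.nonsing_inv_mul _ ((Matrix.isUnit_iff_isUnit_det _).1
        (IsUnit.of_mul_eq_one (M.matrix h) (by rw [← M.matrix_mul, inv_mul_cancel, M.matrix_one])))
    have h4 : M.ρ h⁻¹ m = Matrix.toLin (Module.finBasis ℂ M.carrier) (Module.finBasis ℂ M.carrier)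
        (M.matrix h⁻¹) m := by rw [FinRep.matrix, Matrix.toLin_toMatrix]
    rw [h1, h2, Matrix.mul_inv_rev, h4, ← LinearMap.comp_apply,
      ← Matrix.toLin_mul, mul_assoc, h3, mul_one, Module.Basis.equivFun_apply,
      Matrix.repr_toLin]
    rfl
  exact key _ _ hh

end

end Assoc

end EquivariantK

namespace EquivariantK
-- Local triviality of $G\times_H M$
namespace Assoc

variable {V : Type v} [NormedAddCommGroup V] [NormedSpace ℝ V]
  {G : Type u} [TopologicalSpace G] [Group G] [ChartedSpace V G] [LieGroup 𝓘(ℝ, V) ∞ G]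
  {k : ℕ∞} {H : Subgroup G}

/-- An equivariant matrix-valued function that is `C^k` and invertible on an open set `W` gives
a local frame of the associated bundle over the image of `W`. -/
theorem exists_frame (M : FinRep H)
    {A : G → Matrix (Fin (Module.finrank ℂ M.carrier)) (Fin (Module.finrank ℂ M.carrier)) ℂ}
    (hA : ∀ (g : G) (h : H), A g = M.matrix h * A (g * h)) {W : Set G} (hW : IsOpen W)
    (hAW : ∀ i j, CkOn V k W (fun g => A g i j)) (hdet : ∀ g ∈ W, (A g).det ≠ 0) :
    ∃ e ∈ (family V k M).frames, e.base = (fun g : G => (g : G ⧸ H)) '' W := by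
  have : IsTopologicalGroup G := topologicalGroup_of_lieGroup 𝓘(ℝ, V) ∞
  -- This is the saturation $WH$. Frames are tested on all of it, so smoothness and invertibility of
  -- `A` must be spread from `W` along cosets.
  set s : Set G := {g | (g : G ⧸ H) ∈ (fun g : G => (g : G ⧸ H)) '' W}
  have hs : ∀ g ∈ s, ∃ h : H, g * h ∈ W := by
    rintro g ⟨g', hg', hgg'⟩
    exact ⟨⟨g⁻¹ * g', QuotientGroup.eq.1 hgg'.symm⟩, by simpa using hg'⟩
  have hdets : ∀ g ∈ s, (A g).det ≠ 0 := by
    intro g hg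
    obtain ⟨h, hh⟩ := hs g hg
    have h1 : M.matrix h⁻¹ * M.matrix h = 1 := by
      rw [← M.matrix_mul, inv_mul_cancel, M.matrix_one]
    rw [hA g h, Matrix.det_mul]
    exact mul_ne_zero (fun h0 => by simpa [h0] using congrArg Matrix.det h1) (hdet _ hh)
  have hAs : ∀ i j, CkOn V k s (fun g => A g i j) := fun i j => CkOn.of_locally fun g hg => by
    obtain ⟨h, hh⟩ := hs g hg
    refine ⟨{g | g * h ∈ W}, hW.preimage (continuous_mul_const _), hh, ?_⟩
    -- Near $g$ the element $h$ is fixed, so $A(x)=\rho(h)A(xh)$ has a constant first factor and no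
    -- regularity of $\rho$ is used.
    refine ((CkOn.sum fun l => (CkOn.const (M.matrix h i l)).mul
      ((hAW l j).comp_mul_right (h : G))).mono Set.inter_subset_right).congr fun x _ => ?_
    rw [hA x h, Matrix.mul_apply]
  let e : LocalFrame H (Fibre M) :=
    { base := (fun g : G => (g : G ⧸ H)) '' W
      isOpen_base := QuotientGroup.isOpenMap_coe _ hW
      ι := Fin (Module.finrank ℂ M.carrier)
      vec := frameVec M A
      coord := frameCoord M A
      coord_vec := by
        intro x hx i j
        obtain ⟨g, hg, rfl⟩ := hx
        have hu : (A g)⁻¹ * A g = 1 :=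
          Matrix.nonsing_inv_mul _ (isUnit_iff_ne_zero.2 (hdet g hg))
        rw [frameVec_coe hA, frameCoord_coe hA]
        simp only [Matrix.repr_toLin, Module.Basis.repr_self]
        have := congrFun (congrFun hu j) i
        rw [Matrix.mul_apply, Matrix.one_apply] at this
        simpa [eq_comm, Finsupp.single_eq_pi_single] using this
      sum_coord := by
        intro x hx v
        obtain ⟨g, hg, rfl⟩ := hx
        have hu : A g * (A g)⁻¹ = 1 :=
          Matrix.mul_nonsing_inv _ (isUnit_iff_ne_zero.2 (hdet g hg))
        obtain ⟨m, rfl⟩ := (fibreLin M g rfl).surjective v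
        simp only [frameVec_coe hA, frameCoord_coe hA, ← map_smul, ← map_sum]
        congr 1
        set b := Module.finBasis ℂ M.carrier
        have h1 : ∑ i, (∑ l, (A g)⁻¹ i l * b.repr m l) • b i =
            Matrix.toLin b b (A g)⁻¹ m := by
          rw [Matrix.toLin_apply]
          rfl
        rw [h1, ← LinearMap.comp_apply, ← Matrix.toLin_mul, hu, Matrix.toLin_one]
        rfl }
  -- Pulled back to $G\times M$, the frame has the entries of `A` as its components, and those of
  -- the inverse matrix give its coordinates; both are $C^k$ on `s`.
  refine ⟨e, ⟨fun i l => ?_, fun m j => ?_⟩, rfl⟩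
  · refine (CkOn.sum fun a => (hAs a i).mul (CkOn.const (l (Module.finBasis ℂ M.carrier a)))).congr
      fun g _ => ?_
    change l ((fibreLin M g rfl).symm (frameVec M A g i)) = _
    rw [frameVec_coe hA, LinearEquiv.symm_apply_apply, Matrix.toLin_self, map_sum]
    simp
  · refine (CkOn.sum fun a => (CkOn.matrix_inv hAs hdets j a).mul
      (CkOn.const ((Module.finBasis ℂ M.carrier).repr m a))).congr fun g _ => ?_
    exact frameCoord_coe hA g m j

/-- The associated bundle of a representation of a closed subgroup is locally trivial. -/
theorem family_isLocallyTrivial [FiniteDimensional ℝ V] [T2Space G] (hH : IsClosed (H : Set G))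
    (M : FinRep H) : (family V k M).IsLocallyTrivial := by
  have : IsTopologicalGroup G := topologicalGroup_of_lieGroup 𝓘(ℝ, V) ∞
  intro x
  obtain ⟨a, rfl⟩ := QuotientGroup.mk_surjective x
  obtain ⟨A, hA, hA1, W, hW, hW1, hAW⟩ := exists_equivariant_matrix V hH M
  have hAk : ∀ i j, CkOn V k W (fun g => A g i j) := fun i j =>
    (hAW i j).of_le (by exact_mod_cast le_top)
  have hopen : IsOpen (W ∩ (fun g => (A g).det) ⁻¹' {0}ᶜ) :=
    (ContMDiffOn.continuousOn (CkOn.det hAk)).isOpen_inter_preimage hW isOpen_compl_singleton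
  -- Left translation by $a$ commutes with right multiplication by `H`, so it preserves equivariance
  -- and moves the frame from the identity coset to $aH$.
  obtain ⟨e, he, hb⟩ := exists_frame (V := V) (k := k) M (A := fun g => A (a⁻¹ * g))
    (fun g h => by rw [hA (a⁻¹ * g) h, mul_assoc])
    (W := {g | a⁻¹ * g ∈ W ∩ (fun g => (A g).det) ⁻¹' {0}ᶜ})
    (hopen.preimage (continuous_const_mul _))
    (fun i j => ((hAk i j).comp_mul_left a⁻¹).mono fun g hg => hg.1) fun g hg => hg.2
  refine ⟨e, he, ?_⟩
  rw [hb]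
  exact ⟨a, ⟨by simpa using hW1, by simpa using hA1⟩, rfl⟩

end Assoc
end EquivariantK

namespace EquivariantK

/-! ### Translations between the fibres of a $G$-vector bundle -/

variable {V : Type v} [NormedAddCommGroup V] [NormedSpace ℝ V]
  {G : Type u} [TopologicalSpace G] [Group G] [ChartedSpace V G]
  {k : ℕ∞} {H : Subgroup G}

theorem EquivariantFamily.act_congr (E : EquivariantFamily V k H) {a b : G} (hab : a = b)
    {x y : G ⧸ H} (ha : a • x = y) (hb : b • x = y) (v : E.fib x) : E.act a ha v = E.act b hb v := by
  subst hab; rfl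

theorem EquivariantFamily.act_inv_act (E : EquivariantFamily V k H) (g : G) {x y : G ⧸ H}
    (h : g • x = y) (h' : g⁻¹ • y = x) (v : E.fib x) : E.act g⁻¹ h' (E.act g h v) = v := by
  rw [← E.act_mul g⁻¹ g h h' (by rw [inv_mul_cancel, one_smul]),
    E.act_congr (inv_mul_cancel g) _ (one_smul _ _), E.act_one]

theorem EquivariantFamily.act_act_inv (E : EquivariantFamily V k H) (g : G) {x y : G ⧸ H}
    (h : g • x = y) (h' : g⁻¹ • y = x) (v : E.fib y) : E.act g h (E.act g⁻¹ h' v) = v := by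
  rw [← E.act_mul g g⁻¹ h' h (by rw [mul_inv_cancel, one_smul]),
    E.act_congr (mul_inv_cancel g) _ (one_smul _ _), E.act_one]

/-- The action of a group element as a linear isomorphism between fibres. -/
def EquivariantFamily.actEquiv (E : EquivariantFamily V k H) (g : G) {x y : G ⧸ H}
    (h : g • x = y) : E.fib x ≃ₗ[ℂ] E.fib y :=
  { E.act g h with
    invFun := E.act g⁻¹ (inv_smul_eq_iff.2 h.symm)
    left_inv := E.act_inv_act g h _
    right_inv := E.act_act_inv g h _ }

theorem inv_smul_coset (g : G) : g⁻¹ • (g : G ⧸ H) = ((1 : G) : G ⧸ H) :=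
  inv_smul_eq_iff.2 (smul_identityCoset' g).symm

/-- In local frames, the orbit of a vector in the fibre over the identity coset is `C^k`. -/
theorem GVectorBundle.ckOn_coord_act (E : GVectorBundle V k H) {f : LocalFrame H E.fib}
    (hf : f ∈ E.frames) (v : E.fib ((1 : G) : G ⧸ H)) (j : f.ι) :
    CkOn V k f.pre (fun g => f.coord g (E.act g (smul_identityCoset' g) v) j) := by
  obtain ⟨e, he, hx⟩ := E.isLocallyTrivial ((1 : G) : G ⧸ H)
  have key : ∀ i, CkOn V k f.pre
      (fun g => f.coord g (E.act g (smul_identityCoset' g) (e.vec ((1 : G) : G ⧸ H) i)) j) := by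
    intro i
    -- The action is restricted along $g\mapsto(g,1)$. A general `v` then has constant coordinates
    -- in the frame `e` at the identity coset.
    refine CkOn.congr (ContMDiffOn.comp (E.contMDiff_act e he f hf i j)
      (contMDiff_id.prodMk contMDiff_const : ContMDiff _ _ _ fun g : G => (g, (1 : G))).contMDiffOn
      fun g hg => ⟨hx, ?_⟩) fun g _ => E.coord_act_congr f g (smul_identityCoset' g) _ j
    simpa using hg
  refine (CkOn.sum fun i => (CkOn.const (e.coord _ v i)).mul (key i)).congr fun g _ => ?_
  exact e.map_eq hx ((LinearMap.proj j).comp ((f.coord g).comp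
    (E.act g (smul_identityCoset' g)))) v

/-! ### The comparison map $[g,m]\mapsto gm$ on fibres -/

namespace Assoc

theorem fibreLin_symm_fibreLin (M : FinRep H) (g : G) (h : H)
    (hg : ((g * h : G) : G ⧸ H) = (g : G ⧸ H)) (m : M.carrier) :
    (fibreLin M (g * h) hg).symm (fibreLin M g rfl m) = M.ρ h⁻¹ m := by
  rw [LinearEquiv.symm_apply_eq, fibreLin_mul M g h rfl]
  simp

theorem coset_out_smul (x : G ⧸ H) : x.out • ((1 : G) : G ⧸ H) = x :=
  (smul_identityCoset' x.out).trans (QuotientGroup.out_eq' x)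

/-- The linear isomorphisms `[g, m] ↦ g m` from the fibres of `G ×_H E_H` to those of `E`. -/
noncomputable def toBundle (E : GVectorBundle V k H) (x : G ⧸ H) :
    Fibre E.fibreRep x ≃ₗ[ℂ] E.fib x :=
  (fibreLin E.fibreRep x.out (QuotientGroup.out_eq' x)).symm.trans
    (E.actEquiv x.out (coset_out_smul x))

/-- The map does not depend on the representative used to define it, since $(gh)(h^{-1}m)=gm$. -/
theorem toBundle_fibreLin (E : GVectorBundle V k H) (g : G) (m : E.fib ((1 : G) : G ⧸ H)) :
    toBundle E (g : G ⧸ H) (fibreLin E.fibreRep g rfl m) = E.act g (smul_identityCoset' g) m := by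
  obtain ⟨h, hh⟩ := QuotientGroup.mk_out_eq_mul H g
  have key : ∀ (g' : G) (hg' : (g' : G ⧸ H) = (g : G ⧸ H))
      (hg'' : g' • ((1 : G) : G ⧸ H) = (g : G ⧸ H)), g' = g * h →
      E.act g' hg'' ((fibreLin E.fibreRep g' hg').symm (fibreLin E.fibreRep g rfl m)) =
        E.act g (smul_identityCoset' g) m := by
    rintro _ hg' hg'' rfl
    refine (congrArg (E.act (g * h) hg'')
      (fibreLin_symm_fibreLin E.fibreRep g h hg' m)).trans ?_
    refine (E.act_mul g h (smul_identityCoset h) (smul_identityCoset' g) hg'' _).trans ?_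
    exact congrArg (E.act g (smul_identityCoset' g)) (LinearMap.congr_fun
      (show E.fibreRep.ρ h * E.fibreRep.ρ h⁻¹ = 1 by
        rw [← map_mul, mul_inv_cancel, map_one]) m)
  exact key _ _ (coset_out_smul _) hh

theorem toBundle_symm_apply (E : GVectorBundle V k H) (g : G) (v : E.fib (g : G ⧸ H)) :
    (toBundle E (g : G ⧸ H)).symm v =
      fibreLin E.fibreRep g rfl (E.act g⁻¹ (inv_smul_coset g) v) := by
  rw [LinearEquiv.symm_apply_eq, toBundle_fibreLin, E.act_act_inv]

end Assoc

/-! ### The fibre over the identity coset on isomorphism classes -/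

/-- The fibre over the identity coset, as a map from isomorphism classes of bundles to
isomorphism classes of representations. -/
def Vect.fibre : Vect V k H → RepClass H :=
  Quotient.map GVectorBundle.fibreRep fun _ _ ⟨φ⟩ =>
    ⟨Representation.Equiv.mk (φ.toEquiv ((1 : G) : G ⧸ H)) fun h =>
      LinearMap.ext fun v => φ.map_act (h : G) (smul_identityCoset h) v⟩

/-- Sums of bundles are formed fibre by fibre with the componentwise action, so on representatives
the equality is definitional; tensor products behave alike. -/
theorem Vect.fibre_add (a b : Vect V k H) : fibre (a + b) = fibre a + fibre b := by
  induction a using Quotient.ind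
  induction b using Quotient.ind
  rfl

theorem Vect.fibre_mul (a b : Vect V k H) : fibre (a * b) = fibre a * fibre b := by
  induction a using Quotient.ind
  induction b using Quotient.ind
  rfl

variable [LieGroup 𝓘(ℝ, V) ∞ G]

/-- In local frames, the translation of vectors back to the fibre over the identity coset
is `C^k`. -/
theorem GVectorBundle.ckOn_act_inv (E : GVectorBundle V k H) {f : LocalFrame H E.fib}
    (hf : f ∈ E.frames) (l : Dual ℂ (E.fib ((1 : G) : G ⧸ H))) (i : f.ι) :
    CkOn V k f.pre (fun g => l (E.act g⁻¹ (inv_smul_coset g) (f.vec g i))) := by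
  obtain ⟨e, he, hx⟩ := E.isLocallyTrivial ((1 : G) : G ⧸ H)
  have key : ∀ j, CkOn V k f.pre
      (fun g => e.coord ((1 : G) : G ⧸ H) (E.act g⁻¹ (inv_smul_coset g) (f.vec g i)) j) := by
    intro j
    -- The action is restricted along $g\mapsto(g^{-1},g)$, whose product is constantly $1$;
    -- smoothness of inversion in `G` enters here.
    refine CkOn.congr (ContMDiffOn.comp (E.contMDiff_act f hf e he i j)
      ((((contMDiff_inv 𝓘(ℝ, V) ∞).of_le (by exact_mod_cast le_top)).prodMk contMDiff_id :
        ContMDiff _ _ _ fun g : G => (g⁻¹, g))).contMDiffOn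
      fun g hg => ⟨hg, ?_⟩) fun g _ => E.coord_act_congr e g⁻¹ (inv_smul_coset g) _ j
    change ((g⁻¹ * g : G) : G ⧸ H) ∈ e.base
    rwa [inv_mul_cancel]
  refine (CkOn.sum fun j => (key j).mul (CkOn.const (l (e.vec _ j)))).congr fun g _ => ?_
  exact e.map_eq hx l _

/-! ### Isomorphisms of associated bundles -/

namespace Assoc

/-- A `G`-vector bundle is associated to its fibre over the identity coset. -/
noncomputable def fibreRepIso (E : GVectorBundle V k H) :
    GIso (family V k E.fibreRep) E.toEquivariantFamily where
  toEquiv := toBundle E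
  map_act a x y h v := by
    obtain ⟨g, rfl⟩ := QuotientGroup.mk_surjective x
    subst h
    obtain ⟨m, rfl⟩ := (fibreLin E.fibreRep g rfl).surjective v
    exact (toBundle_fibreLin E (a * g) m).trans ((E.act_mul a g (smul_identityCoset' g) rfl _ m).trans
      (congrArg (E.act a rfl) (toBundle_fibreLin E g m)).symm)
  isCkMap e he f hf i j := by
    -- In a fixed basis of the fibre module, the components of the frame `e` are $C^k$ because `e`
    -- is admitted, and the orbits of the basis vectors are $C^k$ in `f`.
    refine (CkOn.sum fun b =>
      ((he.1 i ((Module.finBasis ℂ E.fibreRep.carrier).coord b)).mono Set.inter_subset_left).mul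
      ((E.ckOn_coord_act hf (Module.finBasis ℂ E.fibreRep.carrier b) j).mono
        Set.inter_subset_right)).congr fun g _ => ?_
    refine (map_fibreLin g ((LinearMap.proj j).comp ((f.coord g).comp
      (toBundle E (g : G ⧸ H)).toLinearMap)) (e.vec g i)).trans (Finset.sum_congr rfl fun b _ => ?_)
    exact congrArg (fun w => _ * f.coord (g : G ⧸ H) w j) (toBundle_fibreLin E g _)
  isCkMap_symm f hf e he i j := by
    -- For the inverse, the frame vectors of `f` are translated back to the identity coset and
    -- expanded there; the coordinates of $[g,b]$ in `e` are $C^k$ because `e` is admitted.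
    refine (CkOn.sum fun b =>
      ((E.ckOn_act_inv hf ((Module.finBasis ℂ E.fibreRep.carrier).coord b) i).mono
        Set.inter_subset_left).mul
      ((he.2 (Module.finBasis ℂ E.fibreRep.carrier b) j).mono
        Set.inter_subset_right)).congr fun g _ => ?_
    refine (map_fibreLin g ((LinearMap.proj j).comp (e.coord g))
      ((toBundle E (g : G ⧸ H)).symm (f.vec g i))).trans (Finset.sum_congr rfl fun b _ => ?_)
    have h1 := (congrArg (fibreLin E.fibreRep g rfl).symm
      (toBundle_symm_apply E g (f.vec g i))).trans (LinearEquiv.symm_apply_apply _ _)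
    exact congrArg (fun w => (Module.finBasis ℂ E.fibreRep.carrier).coord b w * _) h1

/-- The map of associated bundles given by an isomorphism of representations. -/
noncomputable def mapFibre {M N : FinRep H} (φ : M.carrier ≃ₗ[ℂ] N.carrier) (x : G ⧸ H) :
    Fibre M x ≃ₗ[ℂ] Fibre N x :=
  (fibreLin M x.out (QuotientGroup.out_eq' x)).symm.trans
    (φ.trans (fibreLin N x.out (QuotientGroup.out_eq' x)))

/-- Commutation of `φ` with `H` is exactly what makes $[g,m]\mapsto[g,\varphi(m)]$ independent of
the representative. -/
theorem mapFibre_fibreLin {M N : FinRep H} (φ : M.carrier ≃ₗ[ℂ] N.carrier)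
    (hφ : ∀ h m, φ (M.ρ h m) = N.ρ h (φ m)) (g : G) (m : M.carrier) :
    mapFibre φ (g : G ⧸ H) (fibreLin M g rfl m) = fibreLin N g rfl (φ m) := by
  obtain ⟨h, hh⟩ := QuotientGroup.mk_out_eq_mul H g
  have key : ∀ (g' : G) (hg' : (g' : G ⧸ H) = (g : G ⧸ H)), g' = g * h →
      fibreLin N g' hg' (φ ((fibreLin M g' hg').symm (fibreLin M g rfl m))) =
        fibreLin N g rfl (φ m) := by
    rintro _ hg' rfl
    rw [fibreLin_symm_fibreLin, hφ, fibreLin_mul _ g h rfl]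
    simp
  exact key _ _ hh

/-- Pulled back to $G\times M\to G\times N$, such a map is constant in $g$, so only the regularity
of the frames matters. The form with a linear map serves an isomorphism and its inverse alike. -/
theorem isCkMap_of_fibreLin {M N : FinRep H} (φ : M.carrier →ₗ[ℂ] N.carrier)
    (Φ : ∀ x, Fibre M x →ₗ[ℂ] Fibre N x)
    (hΦ : ∀ (g : G) (m), Φ (g : G ⧸ H) (fibreLin M g rfl m) = fibreLin N g rfl (φ m)) :
    IsCkMap (family V k M) (family V k N) Φ := by
  intro e he f hf i j
  refine (CkOn.sum fun b =>
    ((he.1 i ((Module.finBasis ℂ M.carrier).coord b)).mono Set.inter_subset_left).mul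
    ((hf.2 (φ (Module.finBasis ℂ M.carrier b)) j).mono Set.inter_subset_right)).congr fun g _ => ?_
  refine (map_fibreLin g ((LinearMap.proj j).comp ((f.coord g).comp (Φ (g : G ⧸ H))))
    (e.vec g i)).trans (Finset.sum_congr rfl fun b _ => ?_)
  exact congrArg (fun w => _ * f.coord (g : G ⧸ H) w j) (hΦ g _)

variable (V k) in
/-- Isomorphic representations have isomorphic associated bundles. -/
noncomputable def mapIso {M N : FinRep H} (φ : M.carrier ≃ₗ[ℂ] N.carrier)
    (hφ : ∀ h m, φ (M.ρ h m) = N.ρ h (φ m)) : GIso (family V k M) (family V k N) where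
  toEquiv := mapFibre φ
  map_act a x y h v := by
    obtain ⟨g, rfl⟩ := QuotientGroup.mk_surjective x
    subst h
    obtain ⟨m, rfl⟩ := (fibreLin M g rfl).surjective v
    exact (mapFibre_fibreLin φ hφ (a * g) m).trans
      (congrArg (act N a rfl) (mapFibre_fibreLin φ hφ g m)).symm
  isCkMap := isCkMap_of_fibreLin φ.toLinearMap _ (mapFibre_fibreLin φ hφ)
  isCkMap_symm := isCkMap_of_fibreLin φ.symm.toLinearMap _ fun g m =>
    (LinearEquiv.symm_apply_eq (mapFibre φ (g : G ⧸ H))).2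
      ((mapFibre_fibreLin φ hφ g _).trans (by simp)).symm

end Assoc

/-! ### Passage to Grothendieck rings -/

/-- The ring isomorphism of Grothendieck rings induced by an isomorphism of semirings. -/
noncomputable def GrothendieckRing.congr {S T : Type*} [CommSemiring S] [CommSemiring T]
    (f : S ≃+* T) : GrothendieckRing S ≃+* GrothendieckRing T where
  __ := AddMonoidHom.toAddEquiv (lift ((of (S := T)).comp f.toAddMonoidHom))
    (lift ((of (S := S)).comp f.symm.toAddMonoidHom))
    (hom_ext fun a => by simp [lift_of]) (hom_ext fun a => by simp [lift_of])
  map_mul' x y := by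
    change lift _ (x * y) = lift _ x * lift _ y
    -- Both sides are biadditive, so multiplicativity need only be checked on classes of semiring
    -- elements.
    induction x using induction with
    | h a =>
      induction y using induction with
      | h b => simp [← of_mul, lift_of]
      | hs y z hy hz => simp only [mul_sub', map_sub, hy, hz]
    | hs x z hx hz => simp only [sub_mul', map_sub, hx, hz]

theorem GrothendieckRing.congr_of {S T : Type*} [CommSemiring S] [CommSemiring T]
    (f : S ≃+* T) (a : S) : congr f (of a) = of (f a) :=
  lift_of ((of (S := T)).comp f.toAddMonoidHom) a

/-- The representation `M` is the fibre over the identity coset of its associated bundle. -/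
theorem Vect.fibre_family {M : FinRep H} (hM : (Assoc.family V k M).IsLocallyTrivial) :
    fibre (mk ⟨Assoc.family V k M, hM⟩) = RepClass.mk M := by
  refine RepClass.mk_eq (M := GVectorBundle.fibreRep ⟨Assoc.family V k M, hM⟩) (N := M)
    (Assoc.fibreLin M 1 rfl).symm fun h => LinearMap.ext fun v => ?_
  obtain ⟨m, rfl⟩ := (Assoc.fibreLin M 1 rfl).surjective v
  refine Eq.trans ?_ (congrArg (M.ρ h) (LinearEquiv.symm_apply_apply _ m).symm)
  refine (LinearEquiv.symm_apply_eq (Assoc.fibreLin M 1 rfl)).2 (Subtype.ext ?_)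
  -- Equivariance of $m\mapsto[1,m]$ is the relation $h[1,m]=[h,m]=[1,hm]$.
  change Assoc.mk M ((h : G) * 1) m = Assoc.mk M 1 (M.ρ h m)
  rw [← Assoc.mk_mul, mul_one, one_mul]

variable (V k) in
/-- Taking the fibre over the identity coset is an isomorphism of semirings. -/
noncomputable def Vect.fibreEquiv (hM : ∀ M : FinRep H, (Assoc.family V k M).IsLocallyTrivial) :
    Vect V k H ≃+* RepClass H where
  toFun := fibre
  invFun := Quotient.map (fun M => ⟨Assoc.family V k M, hM M⟩) fun _ _ ⟨φ⟩ =>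
    ⟨Assoc.mapIso V k φ.toLinearEquiv fun h m => LinearMap.congr_fun (RepClass.equiv_comm φ h) m⟩
  left_inv a := by
    induction a using Quotient.ind
    exact mk_eq (Assoc.fibreRepIso _)
  right_inv a := by
    induction a using Quotient.ind
    exact fibre_family _
  map_add' := fibre_add
  map_mul' := fibre_mul

end EquivariantK

/-! ### The main theorem -/

open EquivariantK
theorem mainTheorem12 {V : Type v} [NormedAddCommGroup V] [NormedSpace ℝ V] [FiniteDimensional ℝ V]
    {G : Type u} [TopologicalSpace G] [T2Space G] [Group G] [ChartedSpace V G]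
    [LieGroup 𝓘(ℝ, V) ∞ G] (H : Subgroup G) (hH : IsClosed (H : Set G)) (k : ℕ∞) :
    ∃ hM : ∀ M : FinRep H, (Assoc.family V k M).IsLocallyTrivial,
      (∀ E : GVectorBundle V k H,
        ∃ α : GIso (Assoc.family V k E.fibreRep) E.toEquivariantFamily,
          ∀ (g : G) (m : E.fib ((1 : G) : G ⧸ H)),
            α.toEquiv (g : G ⧸ H) ⟨Assoc.mk E.fibreRep g m, rfl⟩ =
              E.act g (smul_identityCoset' g) m) ∧
      ∃ φ : KG V k H ≃+* RepRing H,
        (∀ E : GVectorBundle V k H, φ (KG.mk E) = RepRing.mk E.fibreRep) ∧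
        (∀ M : FinRep H, φ.symm (RepRing.mk M) = KG.mk ⟨Assoc.family V k M, hM M⟩) := by
  have hM := fun M : FinRep H => Assoc.family_isLocallyTrivial (V := V) (k := k) hH M
  have hφ : ∀ E : GVectorBundle V k H,
      GrothendieckRing.congr (Vect.fibreEquiv V k hM) (KG.mk E) = RepRing.mk E.fibreRep := fun E =>
    GrothendieckRing.congr_of _ _
  refine ⟨hM, fun E => ⟨Assoc.fibreRepIso E, fun g m => Assoc.toBundle_fibreLin E g m⟩,
    GrothendieckRing.congr (Vect.fibreEquiv V k hM), hφ, fun M => ?_⟩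
  -- The formula for the inverse reduces to the forward map on $G\times_H M$, whose fibre over the
  -- identity coset is isomorphic to `M`.
  rw [RingEquiv.symm_apply_eq, hφ]
  exact congrArg GrothendieckRing.of (Vect.fibre_family (hM M)).symm
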